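/- **Setting.** Let $S,T$ be arbitrary (possibly infinite) sets and let the alphabet be $\Gamma=[k]$ with $2\le k<\infty$, or $\Gamma=\mathbb N$ (written $k=\infty$). For $f:S\to\Gamma$, $g:T\to\Gamma$ put $\kappa_{f,g}(x,y)=1$ if $f(x)=g(y)$ and $\kappa_{f,g}(x,y)=-1$ otherwise, and let $M_k$ be the set of all functions $\kappa_{f,g}$ on $S\times T$. Let $\operatorname{conv}M_k$ be the set of all functions $(x,y)\mapsto\mathbb E_{(f,g)\sim P}[\kappa_{f,g}(x,y)]$, where $P$ is a probability distribution over pairs $(f,g)$ (on the product $\sigma$-algebra generated by the evaluations); for finite $S,T$ this is the ordinary convex hull of $M_k$. For $Z:S\times T\to\mathbb R$ define, with values in $[0,\infty]$ (and $\inf\emptyset=\infty$), $$\rho_k(Z)=\inf\{r\ge 0: Z\in r\operatorname{conv}M_k\},\qquad \hat\rho_k(Z)=\inf_{\theta\in\mathbb R}\rho_k(Z-\theta),\qquad \rho=\rho_\infty,\ \hat\rho=\hat\rho_\infty,$$ $$\|Z\|_{\max}=\inf_{U,V}\max\Big(\sup_{x\in S}\|U(x)\|^2,\ \sup_{y\in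 T}\|V(y)\|^2\Big),\qquad \|Z\|_{\widehat{\max}}=\inf_{\theta\in\mathbb R}\|Z-\theta\|_{\max},$$ where the infimum is over maps $U:S\to H$, $V:T\to H$ into real Hilbert spaces $H$ with $Z(x,y)=\langle U(x),V(y)\rangle$ for all $x,y$, and an empty supremum is $0$. For $\alpha>0$, an $\alpha$-ALSH for $Z$ over $\Gamma$ is a probability distribution $P$ over pairs $(f,g)$ as above such that for some $\theta\in\mathbb R$ one has $\alpha\,\mathbb E_P[\kappa_{f,g}(x,y)]-\theta=Z(x,y)$ for all $x,y$. Let $K_G$ be the real Grothendieck constant and $K_R=\pi/(2\sinh^{-1}(1))=\pi/(2\ln(1+\sqrt2))$ Krivine's constant. **Theorem.** There is a constant $K$ with $$1.67\le K_G\le K\le K_R\le 1.79$$ such that the following hold. 1. For all $S,T$, all $\mathrm{sim}:S\times T\to\mathbb R$ and all integers $k\ge 2$, $$\tfrac12\|\mathrm{sim}\|_{\widehat{\max}}\le\tfrac12\hat\rho_2(\mathrm{sim})\le\hat\rho(\mathrm{sim})\le\hat\rho_k(\mathrm{sim})\le\hat\rho_2(\mathrm{sim})\le K\|\mathrm{sim}\|_{\widehat{\max}},$$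 $$\tfrac13\|\mathrm{sim}\|_{\max}\le\rho(\mathrm{sim})\le\rho_k(\mathrm{sim})\le\rho_2(\mathrm{sim})\le K\|\mathrm{sim}\|_{\max}.$$ 2. For all $S,T$ and every $k\in\{2,3,\dots\}\cup\{\infty\}$, $\ \{Z:\|Z\|_{\max}\le 1/K\}\subseteq\operatorname{conv}M_k\subseteq\{Z:\|Z\|_{\max}\le 3\}$. 3. For all $S,T,\mathrm{sim}$ and every $k\in\{2,3,\dots\}\cup\{\infty\}$, the infimum $\alpha_k$ of all $\alpha>0$ for which $\mathrm{sim}$ has an $\alpha$-ALSH over the alphabet of size $k$ equals $\hat\rho_k(\mathrm{sim})$; hence $\tfrac12\|\mathrm{sim}\|_{\widehat{\max}}\le\alpha_k\le K\|\mathrm{sim}\|_{\widehat{\max}}$. 4. All inequalities in 1 are tight: for each inequality in the two chains other than the last one of each chain (and for each $k\ge2$ where $k$ occurs) there are $S,T,\mathrm{sim}$ for which both sides are equal, positive and finite; and in the last inequality of each chain $K$ cannot be replaced by any smaller constant. -/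

import Mathlib

open MeasureTheory
open scoped ENNReal NNReal Pointwise

universe u v

noncomputable section

namespace HashCluster

variable {S : Type u} {T : Type v}

open Classical in
/-- The asymmetric cluster incidence function of the pair `f : S → Γ`, `g : T → Γ`:
`1` where `f x = g y` and `-1` elsewhere. -/
def kappa {Γ : Type} (f : S → Γ) (g : T → Γ) (x : S) (y : T) : ℝ :=
  if f x = g y then 1 else -1

/-- The set of all asymmetric cluster incidence functions over `S, T` with alphabet `Γ`. -/
def incidenceSet (Γ : Type) (S : Type u) (T : Type v) : Set (S → T → ℝ) :=
  {Z | ∃ (f : S → Γ) (g : T → Γ), Z = kappa f g}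

/-- The expected incidence `𝔼 κ_{f,g}(x,y)` when the pair of hash functions `(f, g)` is drawn
from `P`. The two function spaces carry the product σ-algebras, i.e. those generated by the
evaluations `f ↦ f x` and `g ↦ g y`. -/
def expectedIncidence {Γ : Type} [MeasurableSpace Γ] (P : Measure ((S → Γ) × (T → Γ)))
    (x : S) (y : T) : ℝ :=
  ∫ h, kappa h.1 h.2 x y ∂P

/-- The convex hull of the set of asymmetric cluster incidence functions, in the sense of
averages with respect to arbitrary probability distributions over pairs of hash functions. For
finite `S` and `T` this is the usual convex hull, see `convIncidence_eq_convexHull`. -/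
def convIncidence (Γ : Type) [MeasurableSpace Γ] (S : Type u) (T : Type v) : Set (S → T → ℝ) :=
  {Z | ∃ P : Measure ((S → Γ) × (T → Γ)), IsProbabilityMeasure P ∧ Z = expectedIncidence P}

/-- The cluster ratio over the alphabet `Γ`: the least `r ≥ 0` with `Z ∈ r • conv M`
(as an infimum, equal to `∞` if there is no such `r`). -/
def clusterRatio (Γ : Type) [MeasurableSpace Γ] (Z : S → T → ℝ) : ℝ≥0∞ :=
  ⨅ (r : ℝ≥0) (_ : Z ∈ (r : ℝ) • convIncidence Γ S T), (r : ℝ≥0∞)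

/-- The centralized cluster ratio over the alphabet `Γ`. -/
def centralizedClusterRatio (Γ : Type) [MeasurableSpace Γ] (Z : S → T → ℝ) : ℝ≥0∞ :=
  ⨅ θ : ℝ, clusterRatio Γ (fun x y => Z x y - θ)

/-- The distribution `P` over pairs of hash functions is an `α`-ALSH for `Z`. -/
def IsALSH {Γ : Type} [MeasurableSpace Γ] (α : ℝ) (P : Measure ((S → Γ) × (T → Γ)))
    (Z : S → T → ℝ) : Prop :=
  0 < α ∧ IsProbabilityMeasure P ∧
    ∃ θ : ℝ, ∀ (x : S) (y : T), α * expectedIncidence P x y - θ = Z x y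

/-- The infimum of all `α > 0` for which there is an `α`-ALSH for `Z` over the alphabet `Γ`. -/
def leastALSH (Γ : Type) [MeasurableSpace Γ] (Z : S → T → ℝ) : ℝ≥0∞ :=
  ⨅ (α : ℝ) (_ : ∃ P : Measure ((S → Γ) × (T → Γ)), IsALSH α P Z), ENNReal.ofReal α

/-- The max-norm: the infimum of `max (sup ‖U x‖²) (sup ‖V y‖²)` over all factorizations
`Z x y = ⟪U x, V y⟫` through a real Hilbert space (equal to `∞` if there is no bounded one). -/
def maxNorm (Z : S → T → ℝ) : ℝ≥0∞ :=
  ⨅ (H : Type (max u v)) (_ : NormedAddCommGroup H) (_ : InnerProductSpace ℝ H)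
    (_ : CompleteSpace H) (U : S → H) (V : T → H) (_ : ∀ x y, Z x y = inner ℝ (U x) (V y)),
    max ((⨆ x, ‖U x‖ₑ) ^ 2) ((⨆ y, ‖V y‖ₑ) ^ 2)

/-- The centralized max-norm. -/
def centralizedMaxNorm (Z : S → T → ℝ) : ℝ≥0∞ :=
  ⨅ θ : ℝ, maxNorm (fun x y => Z x y - θ)

/-- The (real) Grothendieck constant. -/
def grothendieckConstant : ℝ :=
  sInf {C : ℝ | ∀ (m n : ℕ) (A : Matrix (Fin m) (Fin n) ℝ),
    (∀ (s : Fin m → ℝ) (t : Fin n → ℝ), (∀ i, |s i| ≤ 1) → (∀ j, |t j| ≤ 1) →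
      |∑ i, ∑ j, A i j * (s i * t j)| ≤ 1) →
    ∀ (H : Type) [NormedAddCommGroup H] [InnerProductSpace ℝ H] [CompleteSpace H]
      (a : Fin m → H) (b : Fin n → H), (∀ i, ‖a i‖ ≤ 1) → (∀ j, ‖b j‖ ≤ 1) →
      |∑ i, ∑ j, A i j * inner ℝ (a i) (b j)| ≤ C}

/-- Krivine's constant `π / (2 sinh⁻¹ 1) = π / (2 log (1 + √2))`. -/
def krivineConstant : ℝ := Real.pi / (2 * Real.arsinh 1)

theorem measurable_kappa {Γ : Type} [MeasurableSpace Γ] [DiscreteMeasurableSpace Γ] [Countable Γ]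
    (x : S) (y : T) :
    Measurable (fun h : (S → Γ) × (T → Γ) => kappa h.1 h.2 x y) := by
  classical
  have h1 : Measurable (fun h : (S → Γ) × (T → Γ) => (h.1 x, h.2 y)) := by fun_prop
  have h2 : Measurable (fun p : Γ × Γ => if p.1 = p.2 then (1 : ℝ) else -1) :=
    Measurable.of_discrete
  convert h2.comp h1 using 2
  simp only [kappa, Function.comp_apply]

theorem convIncidence_eq_convexHull (Γ : Type) [MeasurableSpace Γ] [DiscreteMeasurableSpace Γ]
    [Countable Γ] (S : Type u) (T : Type v) [Finite S] [Finite T] :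
    convIncidence Γ S T = convexHull ℝ (incidenceSet Γ S T) := by
  classical
  cases nonempty_fintype S
  cases nonempty_fintype T
  have hint : ∀ (P : Measure ((S → Γ) × (T → Γ))) [IsFiniteMeasure P] (x : S) (y : T),
      Integrable (fun h : (S → Γ) × (T → Γ) => kappa h.1 h.2 x y) P := by
    intro P _ x y
    refine Integrable.of_bound (measurable_kappa x y).aestronglyMeasurable 1 (ae_of_all _ ?_)
    intro h
    simp only [kappa]
    split_ifs <;> simp
  have hfin : (incidenceSet Γ S T).Finite := by
    have : (Set.pi Set.univ fun _ : S => Set.pi Set.univ fun _ : T => ({1, -1} : Set ℝ)).Finite :=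
      
      Set.Finite.pi fun _ => Set.Finite.pi fun _ => (Set.finite_singleton (-1 : ℝ)).insert 1
    refine this.subset ?_
    rintro Z ⟨f, g, rfl⟩ x _ y _
    simp only [kappa]
    split_ifs <;> simp
  apply Set.Subset.antisymm
  · rintro Z ⟨P, hP, rfl⟩
    have hI : Integrable (fun h : (S → Γ) × (T → Γ) => (kappa h.1 h.2 : S → T → ℝ)) P :=
      Integrable.of_eval fun x => Integrable.of_eval fun y => hint P x y
    have hmem := (convex_convexHull ℝ (incidenceSet Γ S T)).integral_mem
      (hfin.isClosed_convexHull ℝ) (μ := P)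
      (f := fun h : (S → Γ) × (T → Γ) => (kappa h.1 h.2 : S → T → ℝ))
      (ae_of_all _ fun h => subset_convexHull ℝ _ ⟨h.1, h.2, rfl⟩) hI
    convert hmem using 1
    funext x y
    rw [eval_integral (fun i => Integrable.of_eval fun y => hint P i y),
      eval_integral (fun j => hint P x j)]
    rfl
  · refine convexHull_min ?_ ?_
    · rintro Z ⟨f, g, rfl⟩
      refine ⟨Measure.dirac (f, g), inferInstance, ?_⟩
      funext x y
      simp only [expectedIncidence]
      rw [integral_dirac' _ _ (measurable_kappa x y).stronglyMeasurable]
    · rintro _ ⟨P, hP, rfl⟩ _ ⟨Q, hQ, rfl⟩ a b ha hb hab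
      refine ⟨ENNReal.ofReal a • P + ENNReal.ofReal b • Q, ⟨?_⟩, ?_⟩
      · simp [← ENNReal.ofReal_add ha hb, hab]
      · funext x y
        simp only [expectedIncidence, Pi.add_apply, Pi.smul_apply, smul_eq_mul]
        rw [integral_add_measure ((hint P x y).smul_measure ENNReal.ofReal_ne_top)
          ((hint Q x y).smul_measure ENNReal.ofReal_ne_top), integral_smul_measure,
          integral_smul_measure, ENNReal.toReal_ofReal ha, ENNReal.toReal_ofReal hb]
        simp

end HashCluster

end

/-!
The constant `K` is `ratioConstant`, the least number with `ρ₂(Z) ≤ K ‖Z‖_max` for all `S`, `T`,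
`Z`. That no smaller constant serves in the uncentralized chain is then its definition
(`exists_lt_clusterRatio`); stacking `Z` on top of `-Z` makes shifts useless and transfers this to
the centralized chain (`exists_lt_centralizedClusterRatio`).

*Bounds on `K`.* The binary hull is convex, symmetric and compact: a matrix all of whose finite
restrictions lie in the hull lies in it (`mem_convIncidence_two_of_finset`). Krivine's
argument gives `K ≤ K_R`: for unit vectors, the Gram matrix `sin (c ⟪u, v⟫)` with `sinh c = 1` is
again realised by unit vectors, and the signs of a Gaussian vector along these have correlation
`(2 / π) arcsin (sin (c ⟪u, v⟫))` by Grothendieck's identity. A bound for `ρ₂` bounds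
`∑ A i j ⟪a i, b j⟫` by duality with the signs, so `K_G ≤ K`
(`IsRatioBound.isGrothendieckBound`).

*The bound `1.67 ≤ K_G`* follows Davie and Reeds. On functions of a standard Gaussian vector of
high dimension `n`, take the form that pairs the barycentres `E[f x]` and `E[g x]` and
subtracts a multiple of `E[f g]` (`barycentreForm`). Functions with values in `[-1, 1]`
have barycentres seen by a one-dimensional marginal, and a one-dimensional optimization bounds the
form on them; the unit vector fields `x / ‖x‖` have a value that is larger by a factor
approaching a number above `1.67`. Replacing the Gaussian vector by a nearby one with finitely many
values turns the form into a matrix as in the definition of `K_G`.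

*The remaining inequalities.* Products of signs are inner products in `L²` of their law, so
`‖Z‖_max ≤ ρ₂(Z)`. Hashing the letters of any alphabet to independent fair signs turns an average
incidence function `Z` into the binary average `(Z + 1) / 2`; hence `ρ̂₂ ≤ 2 ρ̂` and, because
constants have max-norm `1`, also `‖Z‖_max ≤ 3 ρ(Z)`. A larger alphabet has a larger hull. An
`α`-ALSH is by definition a representation of a shift of `sim` as `α` times an average.

*Tightness.* The `2 × 2` sign matrix has every ratio and norm equal to `1`. The infinite identity
matrix with entries `±1` has `ρ = ρ̂ = 1`, while testing a factorization of it against a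
reflection along the mean, respectively a projection orthogonal to the mean, shows that its max-norm
is at least `3` and its binary centralized ratio at least `2` (`identity_test`).
-/

universe w

noncomputable section

namespace HashCluster

section

/-! ### Random hash functions -/

variable {S : Type u} {T : Type v} {S' : Type*} {T' : Type*}

theorem abs_kappa {Γ : Type} (f : S → Γ) (g : T → Γ) (x : S) (y : T) : |kappa f g x y| = 1 := by
  unfold kappa; split_ifs <;> simp

theorem abs_le_one_of_mem_convIncidence {Γ : Type} [MeasurableSpace Γ] {Z : S → T → ℝ}
    (hZ : Z ∈ convIncidence Γ S T) (x : S) (y : T) : |Z x y| ≤ 1 := by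
  obtain ⟨P, hP, rfl⟩ := hZ
  have := norm_integral_le_of_norm_le_const (μ := P) (C := 1)
    (f := fun h : (S → Γ) × (T → Γ) => kappa h.1 h.2 x y) (ae_of_all _ fun h => by simp [abs_kappa])
  simpa [expectedIncidence] using this

section Countable

variable {Γ : Type} [MeasurableSpace Γ] [DiscreteMeasurableSpace Γ] [Countable Γ]

theorem integrable_kappa_comp {Ω : Type*} [MeasurableSpace Ω] {P : Measure Ω} [IsFiniteMeasure P]
    {f : Ω → S → Γ} {g : Ω → T → Γ} (hf : ∀ x, Measurable fun ω => f ω x)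
    (hg : ∀ y, Measurable fun ω => g ω y) (x : S) (y : T) :
    Integrable (fun ω => kappa (f ω) (g ω) x y) P := by
  have hm : Measurable fun ω => (f ω, g ω) :=
    (measurable_pi_lambda _ hf).prodMk (measurable_pi_lambda _ hg)
  refine Integrable.of_bound ((measurable_kappa x y).comp hm).aestronglyMeasurable 1
    (ae_of_all _ fun ω => ?_)
  simp [abs_kappa]

theorem integrable_kappa (P : Measure ((S → Γ) × (T → Γ))) [IsFiniteMeasure P] (x : S) (y : T) :
    Integrable (fun h : (S → Γ) × (T → Γ) => kappa h.1 h.2 x y) P :=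
  integrable_kappa_comp (fun x => by fun_prop) (fun y => by fun_prop) x y

/-- The hash functions may live on any probability space: only their joint law matters. -/
theorem integral_kappa_mem_convIncidence {Ω : Type*} [MeasurableSpace Ω] (P : Measure Ω)
    [IsProbabilityMeasure P] {f : Ω → S → Γ} {g : Ω → T → Γ}
    (hf : ∀ x, Measurable fun ω => f ω x) (hg : ∀ y, Measurable fun ω => g ω y) :
    (fun x y => ∫ ω, kappa (f ω) (g ω) x y ∂P) ∈ convIncidence Γ S T := by
  have hm : Measurable fun ω => (f ω, g ω) :=
    (measurable_pi_lambda _ hf).prodMk (measurable_pi_lambda _ hg)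
  refine ⟨P.map fun ω => (f ω, g ω), Measure.isProbabilityMeasure_map hm.aemeasurable, ?_⟩
  funext x y
  rw [expectedIncidence, integral_map hm.aemeasurable
    (measurable_kappa x y).aestronglyMeasurable]

theorem comp_mem_convIncidence {Z : S → T → ℝ} (hZ : Z ∈ convIncidence Γ S T) (a : S' → S)
    (b : T' → T) : (fun x y => Z (a x) (b y)) ∈ convIncidence Γ S' T' := by
  obtain ⟨P, hP, rfl⟩ := hZ
  exact integral_kappa_mem_convIncidence P (f := fun h x => h.1 (a x))
    (g := fun h y => h.2 (b y)) (fun x => by fun_prop) (fun y => by fun_prop)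

theorem kappa_mem_convIncidence (f : S → Γ) (g : T → Γ) : kappa f g ∈ convIncidence Γ S T := by
  have := integral_kappa_mem_convIncidence (Measure.dirac ()) (f := fun _ => f) (g := fun _ => g)
    (fun x => by fun_prop) (fun y => by fun_prop)
  simpa using this

theorem convex_convIncidence : Convex ℝ (convIncidence Γ S T) := by
  rintro _ ⟨P, hP, rfl⟩ _ ⟨Q, hQ, rfl⟩ a b ha hb hab
  refine ⟨ENNReal.ofReal a • P + ENNReal.ofReal b • Q, ⟨?_⟩, ?_⟩
  · simp [← ENNReal.ofReal_add ha hb, hab]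
  · funext x y
    simp only [expectedIncidence, Pi.add_apply, Pi.smul_apply, smul_eq_mul]
    rw [integral_add_measure ((integrable_kappa P x y).smul_measure ENNReal.ofReal_ne_top)
      ((integrable_kappa Q x y).smul_measure ENNReal.ofReal_ne_top), integral_smul_measure,
      integral_smul_measure, ENNReal.toReal_ofReal ha, ENNReal.toReal_ofReal hb]
    simp

theorem one_mem_convIncidence [Nonempty Γ] : (fun _ _ => 1) ∈ convIncidence Γ S T := by
  obtain ⟨c⟩ := ‹Nonempty Γ›
  have := kappa_mem_convIncidence (S := S) (T := T) (fun _ => c) (fun _ => c)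
  convert this using 1
  funext x y
  simp [kappa]

theorem isClosed_convIncidence [Finite S] [Finite T] : IsClosed (convIncidence Γ S T) := by
  rw [convIncidence_eq_convexHull]
  refine Set.Finite.isClosed_convexHull ℝ ?_
  have : (Set.pi Set.univ fun _ : S => Set.pi Set.univ fun _ : T => ({1, -1} : Set ℝ)).Finite :=
    Set.Finite.pi fun _ => Set.Finite.pi fun _ => (Set.finite_singleton (-1 : ℝ)).insert 1
  refine this.subset ?_
  rintro Z ⟨f, g, rfl⟩ x _ y _
  simp only [kappa]
  split_ifs <;> simp

end Countable

theorem convIncidence_subset_of_injective {Γ Δ : Type} [MeasurableSpace Γ]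
    [DiscreteMeasurableSpace Γ] [MeasurableSpace Δ] [DiscreteMeasurableSpace Δ] [Countable Δ]
    (φ : Γ → Δ) (hφ : Function.Injective φ) :
    convIncidence Γ S T ⊆ convIncidence Δ S T := by
  rintro _ ⟨P, hP, rfl⟩
  convert integral_kappa_mem_convIncidence P (f := fun h x => φ (h.1 x))
    (g := fun h y => φ (h.2 y)) (fun x => ?_) (fun y => ?_) using 1
  · funext x y
    refine integral_congr_ae (ae_of_all _ fun h => ?_)
    by_cases e : h.1 x = h.2 y <;> simp [kappa, hφ.eq_iff, e]
  · exact (Measurable.of_discrete (f := φ)).comp (by fun_prop)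
  · exact (Measurable.of_discrete (f := φ)).comp (by fun_prop)

/-! ### The binary alphabet -/

/-- Renaming the letters on one side only turns every incidence into its negative. -/
theorem neg_mem_convIncidence_two {Z : S → T → ℝ} (hZ : Z ∈ convIncidence (Fin 2) S T) :
    -Z ∈ convIncidence (Fin 2) S T := by
  obtain ⟨P, hP, rfl⟩ := hZ
  have h := integral_kappa_mem_convIncidence P (f := fun h x => h.1 x + 1) (g := fun h y => h.2 y)
    (fun x => (Measurable.of_discrete (f := fun i : Fin 2 => i + 1)).comp (by fun_prop))
    (fun y => by fun_prop)
  convert h using 1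
  funext x y
  rw [Pi.neg_apply, Pi.neg_apply, expectedIncidence, ← integral_neg]
  refine integral_congr_ae (ae_of_all _ fun h => ?_)
  have key : ∀ i j : Fin 2, (i + 1 = j ↔ ¬ i = j) := by decide
  simp only [kappa, key]
  split_ifs <;> simp

theorem smul_mem_convIncidence_two {Z : S → T → ℝ} (hZ : Z ∈ convIncidence (Fin 2) S T) {c : ℝ}
    (hc : |c| ≤ 1) : c • Z ∈ convIncidence (Fin 2) S T := by
  have h := abs_le.1 hc
  have := convex_convIncidence hZ (neg_mem_convIncidence_two hZ) (a := (1 + c) / 2)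
    (b := (1 - c) / 2) (by linarith) (by linarith) (by ring)
  convert this using 1
  rw [smul_neg, ← sub_eq_add_neg, ← sub_smul]
  congr 1
  ring

/-- The probability space may carry real hash functions with values `±1`, in which case the
incidence of the pair is their product. -/
theorem integral_sign_mul_mem_convIncidence {Ω : Type*} [MeasurableSpace Ω] (P : Measure Ω)
    [IsProbabilityMeasure P] {f : Ω → S → ℝ} {g : Ω → T → ℝ}
    (hf : ∀ x, Measurable fun ω => f ω x) (hg : ∀ y, Measurable fun ω => g ω y)
    (hf1 : ∀ ω x, f ω x = 1 ∨ f ω x = -1) (hg1 : ∀ ω y, g ω y = 1 ∨ g ω y = -1) :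
    (fun x y => ∫ ω, f ω x * g ω y ∂P) ∈ convIncidence (Fin 2) S T := by
  have hm : Measurable fun t : ℝ => if 0 ≤ t then (0 : Fin 2) else 1 :=
    Measurable.ite measurableSet_Ici measurable_const measurable_const
  have h := integral_kappa_mem_convIncidence P
    (f := fun ω x => if 0 ≤ f ω x then (0 : Fin 2) else 1)
    (g := fun ω y => if 0 ≤ g ω y then (0 : Fin 2) else 1)
    (fun x => hm.comp (hf x)) (fun y => hm.comp (hg y))
  convert h using 1
  funext x y
  refine integral_congr_ae (ae_of_all _ fun ω => ?_)
  rcases hf1 ω x with h1 | h1 <;> rcases hg1 ω y with h2 | h2 <;> simp [kappa, h1, h2]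

/-- A letter of the binary alphabet as a sign. -/
def sgn (i : Fin 2) : ℝ := if i = 0 then 1 else -1

theorem abs_sgn (i : Fin 2) : |sgn i| = 1 := by
  unfold sgn; split_ifs <;> simp

theorem sgn_mul_sgn (i j : Fin 2) : sgn i * sgn j = if i = j then 1 else -1 := by
  fin_cases i <;> fin_cases j <;> simp [sgn]

theorem kappa_two (f : S → Fin 2) (g : T → Fin 2) (x : S) (y : T) :
    kappa f g x y = sgn (f x) * sgn (g y) := by
  rw [sgn_mul_sgn]
  simp [kappa]

/-! ### Compactness -/

open Filter Topology in
/-- A positive normalised linear functional on the continuous functions of a compact space, given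
as a pointwise limit of averages along an ultrafilter, is integration against a probability
measure. -/
theorem exists_isProbabilityMeasure_tendsto {X : Type*} [TopologicalSpace X] [T2Space X]
    [CompactSpace X] [MeasurableSpace X] [BorelSpace X] {ι : Type*} (l : Ultrafilter ι)
    (Λ : ι → C(X, ℝ) →ₗ[ℝ] ℝ) (hpos : ∀ i φ, (∀ x, 0 ≤ φ x) → 0 ≤ Λ i φ) (hone : ∀ i, Λ i 1 = 1) :
    ∃ μ : Measure X, IsProbabilityMeasure μ ∧
      ∀ φ : C(X, ℝ), Tendsto (fun i => Λ i φ) l (𝓝 (∫ x, φ x ∂μ)) := by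
  have hbd : ∀ i φ, Λ i φ ∈ Set.Icc (-‖φ‖) ‖φ‖ := by
    intro i φ
    have h1 := hpos i (‖φ‖ • 1 - φ) fun x => by
      simpa using (le_abs_self _).trans (φ.norm_coe_le_norm x)
    have h2 := hpos i (‖φ‖ • 1 + φ) fun x => by
      have := (neg_le_abs _).trans (φ.norm_coe_le_norm x)
      simp only [ContinuousMap.add_apply, ContinuousMap.smul_apply, ContinuousMap.one_apply,
        smul_eq_mul, mul_one]
      linarith
    rw [map_sub, map_smul, hone, smul_eq_mul, mul_one] at h1
    rw [map_add, map_smul, hone, smul_eq_mul, mul_one] at h2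
    constructor <;> linarith
  -- The limits exist because `Λ i φ` stays in a compact interval.
  have hlim : ∀ φ, ∃ a : ℝ, Tendsto (fun i => Λ i φ) l (𝓝 a) := by
    intro φ
    obtain ⟨a, -, ha⟩ := isCompact_Icc.ultrafilter_le_nhds (l.map fun i => Λ i φ)
      (by
        rw [Ultrafilter.coe_map, le_principal_iff]
        exact mem_map.2 (univ_mem' fun i => hbd i φ))
    exact ⟨a, ha⟩
  choose L hL using hlim
  let Λ₀ : CompactlySupportedContinuousMap X ℝ →ₗ[ℝ] ℝ :=
    { toFun := fun φ => L φ.toContinuousMap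
      map_add' := fun φ ψ => tendsto_nhds_unique (hL _) (by
        have := (hL φ.toContinuousMap).add (hL ψ.toContinuousMap)
        simp only [← map_add] at this
        exact this)
      map_smul' := fun c φ => tendsto_nhds_unique (hL _) (by
        have := (hL φ.toContinuousMap).const_mul c
        simp only [← smul_eq_mul, ← map_smul] at this
        exact this) }
  have hΛ₀ : ∀ φ, 0 ≤ φ → 0 ≤ Λ₀ φ := fun φ hφ =>
    ge_of_tendsto' (hL _) fun i => hpos i _ fun x => hφ x
  -- The Riesz–Markov–Kakutani theorem represents the limit functional.
  let Λ₁ := PositiveLinearMap.mk₀ Λ₀ hΛ₀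
  let μ := RealRMK.rieszMeasure Λ₁
  have hint : ∀ φ : C(X, ℝ), ∫ x, φ x ∂μ = L φ := fun φ =>
    RealRMK.integral_rieszMeasure Λ₁ ⟨φ, HasCompactSupport.of_compactSpace _⟩
  have hfin : IsFiniteMeasureOnCompacts μ := by
    dsimp only [μ]; infer_instance
  have hfin' : IsFiniteMeasure μ := ⟨isCompact_univ.measure_lt_top⟩
  refine ⟨μ, ⟨?_⟩, fun φ => by rw [hint]; exact hL φ⟩
  have h1 : L 1 = 1 := tendsto_nhds_unique (hL 1) (by simp [hone])
  have h2 := hint 1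
  rw [h1] at h2
  simp only [ContinuousMap.one_apply, integral_const, smul_eq_mul, mul_one, Measure.real] at h2
  rw [← ENNReal.ofReal_toReal (measure_ne_top μ Set.univ), h2, ENNReal.ofReal_one]

open Filter Topology in
/-- Membership in the binary convex hull is decided on finite subsets of the domains: a limit of
laws witnessing it there is a law on the compact space of all pairs of hash functions. -/
theorem mem_convIncidence_two_of_finset {Z : S → T → ℝ}
    (hZ : ∀ (F : Finset S) (G : Finset T),
      (fun (x : F) (y : G) => Z x y) ∈ convIncidence (Fin 2) F G) :
    Z ∈ convIncidence (Fin 2) S T := by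
  classical
  choose P hP hPZ using fun i : Finset S × Finset T => hZ i.1 i.2
  let X := (S → Fin 2) × (T → Fin 2)
  -- A pair of hash functions on finite subsets is extended by the letter `0`.
  let e : ∀ i : Finset S × Finset T, (i.1 → Fin 2) × (i.2 → Fin 2) → X := fun i h =>
    (fun x => if hx : x ∈ i.1 then h.1 ⟨x, hx⟩ else 0,
      fun y => if hy : y ∈ i.2 then h.2 ⟨y, hy⟩ else 0)
  let Λ : Finset S × Finset T → C(X, ℝ) →ₗ[ℝ] ℝ := fun i =>
    { toFun := fun φ => ∫ h, φ (e i h) ∂(P i)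
      map_add' := fun φ ψ => integral_add (Integrable.of_finite) (Integrable.of_finite)
      map_smul' := fun c φ => integral_const_mul c _ }
  let p : X → S → Fin 2 := Prod.fst
  let q : X → T → Fin 2 := Prod.snd
  have hp : Continuous p := continuous_fst
  have hq : Continuous q := continuous_snd
  -- Borel sets, needed for the Riesz measure, may exceed the product σ-algebra; the push-forward
  -- to the latter happens in `integral_kappa_mem_convIncidence`.
  let _ : MeasurableSpace X := borel X
  have _ : BorelSpace X := ⟨rfl⟩
  obtain ⟨μ, hμ, hlim⟩ := exists_isProbabilityMeasure_tendsto
    (Ultrafilter.of (atTop : Filter (Finset S × Finset T))) Λ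
    (fun i φ hφ => integral_nonneg fun h => hφ _) (fun i => by simp [Λ])
  let φ : S → T → C(X, ℝ) := fun x y =>
    ⟨fun h => sgn (p h x) * sgn (q h y), by
      have : Continuous sgn := continuous_of_discreteTopology
      fun_prop⟩
  have hZμ : Z = fun x y => ∫ h : X, kappa (p h) (q h) x y ∂μ := by
    funext x y
    have hev : ∀ᶠ i in (Ultrafilter.of (atTop : Filter (Finset S × Finset T)) : Filter _),
        Λ i (φ x y) = Z x y := by
      refine (Ultrafilter.of_le (atTop : Filter (Finset S × Finset T))) ?_
      refine (eventually_ge_atTop (({x}, {y}) : Finset S × Finset T)).mono fun i hi => ?_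
      have hx : x ∈ i.1 := hi.1 (by simp)
      have hy : y ∈ i.2 := hi.2 (by simp)
      have := congrFun (congrFun (hPZ i) ⟨x, hx⟩) ⟨y, hy⟩
      dsimp only at this
      rw [this, expectedIncidence]
      refine integral_congr_ae (ae_of_all _ fun h => ?_)
      simp [φ, e, p, q, hx, hy, kappa_two]
    have h1 := tendsto_nhds_unique (hlim (φ x y)) (tendsto_const_nhds.congr'
      (hev.mono fun i hi => hi.symm))
    rw [← h1]
    refine integral_congr_ae (ae_of_all _ fun h => ?_)
    simp [φ, kappa_two]
  rw [hZμ]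
  exact integral_kappa_mem_convIncidence μ (f := p) (g := q)
    (fun x => Continuous.measurable (by fun_prop)) (fun y => Continuous.measurable (by fun_prop))

end

section

variable {S : Type u} {T : Type v} {S' : Type*} {T' : Type*}

/-! ### Factorizations through Hilbert spaces -/

theorem iSup_enorm_sq_le {ι : Type*} {H : Type*} [NormedAddCommGroup H] {w : ι → H} {m : ℝ}
    (hw : ∀ i, ‖w i‖ ^ 2 ≤ m) : (⨆ i, ‖w i‖ₑ) ^ 2 ≤ ENNReal.ofReal m := by
  rcases isEmpty_or_nonempty ι with hι | ⟨⟨i₀⟩⟩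
  · simp
  have hm : 0 ≤ m := (sq_nonneg _).trans (hw i₀)
  have h1 : (⨆ i, ‖w i‖ₑ) ≤ ENNReal.ofReal (√m) := by
    refine iSup_le fun i => ?_
    rw [← ofReal_norm]
    exact ENNReal.ofReal_le_ofReal (Real.le_sqrt_of_sq_le (hw i))
  calc (⨆ i, ‖w i‖ₑ) ^ 2 ≤ ENNReal.ofReal (√m) ^ 2 := by gcongr
    _ = ENNReal.ofReal m := by rw [← ENNReal.ofReal_pow (Real.sqrt_nonneg _), Real.sq_sqrt hm]

theorem maxNorm_le_of_inner {Z : S → T → ℝ} {H : Type (max u v)} [NormedAddCommGroup H]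
    [InnerProductSpace ℝ H] [CompleteSpace H] {U : S → H} {V : T → H} {m : ℝ}
    (hZ : ∀ x y, Z x y = inner ℝ (U x) (V y)) (hU : ∀ x, ‖U x‖ ^ 2 ≤ m)
    (hV : ∀ y, ‖V y‖ ^ 2 ≤ m) : maxNorm Z ≤ ENNReal.ofReal m := by
  unfold maxNorm
  refine iInf_le_of_le H (iInf_le_of_le ‹_› (iInf_le_of_le ‹_› (iInf_le_of_le ‹_› ?_)))
  exact iInf_le_of_le U (iInf_le_of_le V (iInf_le_of_le hZ
    (max_le (iSup_enorm_sq_le hU) (iSup_enorm_sq_le hV))))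

theorem maxNorm_smul_le_of_inner {Z : S → T → ℝ} {H : Type (max u v)} [NormedAddCommGroup H]
    [InnerProductSpace ℝ H] [CompleteSpace H] {U : S → H} {V : T → H} {m c : ℝ} (hc : 0 ≤ c)
    (hZ : ∀ x y, Z x y = inner ℝ (U x) (V y)) (hU : ∀ x, ‖U x‖ ^ 2 ≤ m)
    (hV : ∀ y, ‖V y‖ ^ 2 ≤ m) : maxNorm (c • Z) ≤ ENNReal.ofReal (c * m) := by
  refine maxNorm_le_of_inner (U := fun x => √c • U x) (V := fun y => √c • V y) (fun x y => ?_)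
    (fun x => ?_) fun y => ?_
  · rw [real_inner_smul_left, real_inner_smul_right, ← mul_assoc, Real.mul_self_sqrt hc, ← hZ]
    rfl
  · rw [norm_smul, mul_pow, Real.norm_eq_abs, sq_abs, Real.sq_sqrt hc]
    gcongr
    exact hU x
  · rw [norm_smul, mul_pow, Real.norm_eq_abs, sq_abs, Real.sq_sqrt hc]
    gcongr
    exact hV y

theorem exists_inner_of_maxNorm_lt {Z : S → T → ℝ} {m : ℝ} (hZ : maxNorm Z < ENNReal.ofReal m) :
    ∃ (H : Type (max u v)) (_ : NormedAddCommGroup H) (_ : InnerProductSpace ℝ H)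
      (_ : CompleteSpace H) (U : S → H) (V : T → H),
      (∀ x y, Z x y = inner ℝ (U x) (V y)) ∧ (∀ x, ‖U x‖ ^ 2 ≤ m) ∧ ∀ y, ‖V y‖ ^ 2 ≤ m := by
  unfold maxNorm at hZ
  simp only [iInf_lt_iff] at hZ
  obtain ⟨H, i1, i2, i3, U, V, h, hlt⟩ := hZ
  have hm : 0 ≤ m := by
    by_contra hm
    rw [ENNReal.ofReal_of_nonpos (by linarith)] at hlt
    exact not_lt_bot hlt
  refine ⟨H, i1, i2, i3, U, V, h, fun x => ?_, fun y => ?_⟩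
  · have h1 : ‖U x‖ₑ ^ 2 ≤ ENNReal.ofReal m := by
      refine le_trans ?_ ((le_max_left _ _).trans hlt.le)
      gcongr
      exact le_iSup (fun x => ‖U x‖ₑ) x
    rwa [← ofReal_norm, ← ENNReal.ofReal_pow (norm_nonneg _),
      ENNReal.ofReal_le_ofReal_iff hm] at h1
  · have h1 : ‖V y‖ₑ ^ 2 ≤ ENNReal.ofReal m := by
      refine le_trans ?_ ((le_max_right _ _).trans hlt.le)
      gcongr
      exact le_iSup (fun x => ‖V x‖ₑ) y
    rwa [← ofReal_norm, ← ENNReal.ofReal_pow (norm_nonneg _),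
      ENNReal.ofReal_le_ofReal_iff hm] at h1

/-- A linear test: a bound that holds for all factorizations of `Z` passes to its max-norm. -/
theorem ofReal_le_maxNorm {Z : S → T → ℝ} {c : ℝ}
    (h : ∀ (H : Type (max u v)) [NormedAddCommGroup H] [InnerProductSpace ℝ H] (m : ℝ) (U : S → H)
      (V : T → H), (∀ x y, Z x y = inner ℝ (U x) (V y)) → (∀ x, ‖U x‖ ^ 2 ≤ m) →
      (∀ y, ‖V y‖ ^ 2 ≤ m) → c ≤ m) :
    ENNReal.ofReal c ≤ maxNorm Z := by
  by_contra hlt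
  rw [not_le] at hlt
  obtain ⟨m, h1, h2⟩ := ENNReal.lt_iff_exists_real_btwn.1 hlt
  obtain ⟨H, i1, i2, i3, U, V, hZ, hU, hV⟩ := exists_inner_of_maxNorm_lt h2.1
  have := h H m U V hZ hU hV
  exact absurd h2.2 (not_lt.2 (ENNReal.ofReal_le_ofReal this))

theorem ofReal_abs_le_maxNorm (Z : S → T → ℝ) (x : S) (y : T) :
    ENNReal.ofReal |Z x y| ≤ maxNorm Z := by
  refine ofReal_le_maxNorm fun H _ _ m U V hZ hU hV => ?_
  rw [hZ]
  have := abs_real_inner_le_norm (U x) (V y)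
  nlinarith [sq_nonneg (‖U x‖ - ‖V y‖), hU x, hV y]

/-- Averages of products of signs factor through `L²` of the law of the signs. -/
theorem exists_inner_of_mem_convIncidence_two {Z : S → T → ℝ}
    (hZ : Z ∈ convIncidence (Fin 2) S T) :
    ∃ (H : Type (max u v)) (_ : NormedAddCommGroup H) (_ : InnerProductSpace ℝ H)
      (_ : CompleteSpace H) (U : S → H) (V : T → H),
      (∀ x y, Z x y = inner ℝ (U x) (V y)) ∧ (∀ x, ‖U x‖ ^ 2 ≤ 1) ∧ ∀ y, ‖V y‖ ^ 2 ≤ 1 := by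
  obtain ⟨P, hP, rfl⟩ := hZ
  have hU : ∀ x : S, MemLp (fun h : (S → Fin 2) × (T → Fin 2) => sgn (h.1 x)) 2 P := fun x =>
    MemLp.of_bound (Measurable.aestronglyMeasurable
      ((Measurable.of_discrete (f := sgn)).comp (by fun_prop))) 1
      (ae_of_all _ fun h => (abs_sgn _).le)
  have hV : ∀ y : T, MemLp (fun h : (S → Fin 2) × (T → Fin 2) => sgn (h.2 y)) 2 P := fun y =>
    MemLp.of_bound (Measurable.aestronglyMeasurable
      ((Measurable.of_discrete (f := sgn)).comp (by fun_prop))) 1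
      (ae_of_all _ fun h => (abs_sgn _).le)
  have hin : ∀ (a b : (S → Fin 2) × (T → Fin 2) → ℝ) (ha : MemLp a 2 P) (hb : MemLp b 2 P),
      inner ℝ ha.toLp hb.toLp = ∫ h, a h * b h ∂P := by
    intro a b ha hb
    rw [L2.inner_def]
    refine integral_congr_ae ?_
    filter_upwards [ha.coeFn_toLp, hb.coeFn_toLp] with h h1 h2
    rw [h1, h2]
    simp [mul_comm]
  refine ⟨Lp ℝ 2 P, inferInstance, inferInstance, inferInstance, fun x => (hU x).toLp,
    fun y => (hV y).toLp, fun x y => ?_, fun x => ?_, fun y => ?_⟩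
  · simp only [hin, expectedIncidence, kappa_two]
  · rw [← real_inner_self_eq_norm_sq, hin]
    simp [sgn_mul_sgn]
  · rw [← real_inner_self_eq_norm_sq, hin]
    simp [sgn_mul_sgn]

/-! ### Hashing the letters to random signs -/

/-- Independent fair signs for the letters of an alphabet: the signs of two letters have the same
value if the letters are equal, and are uncorrelated otherwise. -/
theorem exists_random_signs (Γ : Type) :
    ∃ ν : Measure (Γ → Fin 2), IsProbabilityMeasure ν ∧
      ∀ i j, i ≠ j → ∫ b, sgn (b i) * sgn (b j) ∂ν = 0 := by
  let c : Measure (Fin 2) := (PMF.uniformOfFintype (Fin 2)).toMeasure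
  have hc : ∫ a, sgn a ∂c = 0 := by
    rw [integral_fintype Integrable.of_finite]
    simp [c, sgn, Measure.real]
  refine ⟨Measure.infinitePi fun _ => c, inferInstance, fun i j hij => ?_⟩
  have hind := ProbabilityTheory.iIndepFun_infinitePi (P := fun _ : Γ => c) (X := fun _ => sgn)
    (fun _ => Measurable.of_discrete)
  have hm : ∀ i, Measurable fun b : Γ → Fin 2 => sgn (b i) := fun i =>
    (Measurable.of_discrete (f := sgn)).comp (by fun_prop)
  have hmean : ∫ b, sgn (b i) ∂(Measure.infinitePi fun _ : Γ => c) = 0 := by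
    have := integral_map (μ := Measure.infinitePi fun _ : Γ => c) (φ := fun b => b i) (f := sgn)
      (measurable_pi_apply i).aemeasurable Measurable.of_discrete.aestronglyMeasurable
    rw [Measure.infinitePi_map_eval (fun _ : Γ => c) i] at this
    rw [← this, hc]
  rw [(hind.indepFun hij).integral_fun_mul_eq_mul_integral (hm i).aestronglyMeasurable
    (hm j).aestronglyMeasurable, hmean, zero_mul]

/-- Hashing the letters of any alphabet to independent signs halves the incidences, up to a shift:
distinct letters collide with probability one half. -/
theorem half_add_one_mem_convIncidence_two {Γ : Type} [MeasurableSpace Γ]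
    [DiscreteMeasurableSpace Γ] [Countable Γ] {Z : S → T → ℝ} (hZ : Z ∈ convIncidence Γ S T) :
    (fun x y => (Z x y + 1) / 2) ∈ convIncidence (Fin 2) S T := by
  obtain ⟨P, hP, rfl⟩ := hZ
  obtain ⟨ν, hν, hcoin⟩ := exists_random_signs Γ
  have hev : Measurable fun p : Γ × (Γ → Fin 2) => p.2 p.1 :=
    measurable_from_prod_countable_right fun i => by dsimp only; fun_prop
  have hf : ∀ x, Measurable fun ω : ((S → Γ) × (T → Γ)) × (Γ → Fin 2) => ω.2 (ω.1.1 x) :=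
    fun x => hev.comp (g := fun p : Γ × (Γ → Fin 2) => p.2 p.1)
      (f := fun ω : ((S → Γ) × (T → Γ)) × (Γ → Fin 2) => (ω.1.1 x, ω.2)) (by fun_prop)
  have hg : ∀ y, Measurable fun ω : ((S → Γ) × (T → Γ)) × (Γ → Fin 2) => ω.2 (ω.1.2 y) :=
    fun y => hev.comp (g := fun p : Γ × (Γ → Fin 2) => p.2 p.1)
      (f := fun ω : ((S → Γ) × (T → Γ)) × (Γ → Fin 2) => (ω.1.2 y, ω.2)) (by fun_prop)
  have h := integral_kappa_mem_convIncidence (P.prod ν) (f := fun ω x => ω.2 (ω.1.1 x))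
    (g := fun ω y => ω.2 (ω.1.2 y)) hf hg
  convert h using 1
  funext x y
  rw [integral_prod _ (integrable_kappa_comp hf hg x y), expectedIncidence]
  have hin : ∀ h : (S → Γ) × (T → Γ), ∫ b, kappa (fun x => b (h.1 x)) (fun y => b (h.2 y)) x y ∂ν =
      (kappa h.1 h.2 x y + 1) / 2 := by
    intro h
    simp only [kappa_two]
    by_cases e : h.1 x = h.2 y
    · simp [kappa, e, sgn_mul_sgn]
    · simp [kappa, e, hcoin]
  simp only [hin]
  rw [integral_div, integral_add (integrable_kappa P x y) (integrable_const _)]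
  simp

/-- Writing an average of incidences as `2 W - 1`, with `W` an average over the binary alphabet,
splits its factorization as `√2 U ⊕ 1`, `√2 V ⊕ (-1)`, whose norms squared are `3`. -/
theorem maxNorm_smul_le_of_mem_convIncidence {Γ : Type} [MeasurableSpace Γ]
    [DiscreteMeasurableSpace Γ] [Countable Γ] {Z : S → T → ℝ} (hZ : Z ∈ convIncidence Γ S T)
    {c : ℝ} (hc : 0 ≤ c) : maxNorm (c • Z) ≤ ENNReal.ofReal (c * 3) := by
  obtain ⟨H, i1, i2, i3, U, V, hW, hU, hV⟩ :=
    exists_inner_of_mem_convIncidence_two (half_add_one_mem_convIncidence_two hZ)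
  refine maxNorm_smul_le_of_inner (H := WithLp 2 (H × ℝ))
    (U := fun x => WithLp.toLp 2 (√2 • U x, (1 : ℝ)))
    (V := fun y => WithLp.toLp 2 (√2 • V y, (-1 : ℝ))) hc (fun x y => ?_) (fun x => ?_) fun y => ?_
  · have := hW x y
    rw [WithLp.prod_inner_apply]
    simp only [real_inner_smul_left, real_inner_smul_right, ← this, ← mul_assoc]
    norm_num
    ring
  · rw [WithLp.prod_norm_sq_eq_of_L2]
    have := hU x
    simp [norm_smul, mul_pow]
    linarith
  · rw [WithLp.prod_norm_sq_eq_of_L2]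
    have := hV y
    simp [norm_smul, mul_pow]
    linarith

theorem maxNorm_smul_le_of_mem_convIncidence_two {Z : S → T → ℝ}
    (hZ : Z ∈ convIncidence (Fin 2) S T) {c : ℝ} (hc : 0 ≤ c) :
    maxNorm (c • Z) ≤ ENNReal.ofReal c := by
  obtain ⟨H, i1, i2, i3, U, V, hW, hU, hV⟩ := exists_inner_of_mem_convIncidence_two hZ
  simpa using maxNorm_smul_le_of_inner hc hW hU hV

end

section

/-! ### Rounding Gaussian vectors to signs -/

open ProbabilityTheory Real

/-- The sign of a real number, with the value `1` at `0`, so that it only takes the values `±1`. -/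
def hardSign (t : ℝ) : ℝ := if 0 ≤ t then 1 else -1

theorem hardSign_eq (t : ℝ) : hardSign t = 1 ∨ hardSign t = -1 := by
  unfold hardSign; split_ifs <;> simp

theorem hardSign_of_nonneg {t : ℝ} (h : 0 ≤ t) : hardSign t = 1 := if_pos h

theorem hardSign_of_neg {t : ℝ} (h : t < 0) : hardSign t = -1 := if_neg (not_le.2 h)

@[fun_prop]
theorem measurable_hardSign : Measurable hardSign :=
  Measurable.ite measurableSet_Ici measurable_const measurable_const

theorem hardSign_mul_of_pos {r : ℝ} (hr : 0 < r) (t : ℝ) : hardSign (r * t) = hardSign t := by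
  simp [hardSign, hr]

/-- A function on the plane that is constant on rays has the same average against the Gaussian
measure as over the circle. -/
theorem integral_gaussian_prod_of_homogeneous {F : ℝ × ℝ → ℝ}
    (hF : ∀ r : ℝ, 0 < r → ∀ a b, F (r * a, r * b) = F (a, b)) :
    ∫ p, F p ∂((gaussianReal 0 1).prod (gaussianReal 0 1)) =
      (2 * π)⁻¹ * ∫ θ in (-π)..π, F (cos θ, sin θ) := by
  have polar : ∀ F : ℝ × ℝ → ℝ, (∀ r : ℝ, 0 < r → ∀ a b, F (r * a, r * b) = F (a, b)) →
      ∫ p, F p ∂((gaussianReal 0 1).prod (gaussianReal 0 1)) =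
        (∫ r in Set.Ioi (0 : ℝ), r * ((2 * π)⁻¹ * exp (-r ^ 2 / 2))) *
          ∫ θ in (-π)..π, F (cos θ, sin θ) := by
    intro F hF
    have hdens : ∀ p : ℝ × ℝ, (gaussianPDF 0 1 p.1 * gaussianPDF 0 1 p.2).toReal =
        (2 * π)⁻¹ * exp (-(p.1 ^ 2 + p.2 ^ 2) / 2) := by
      intro p
      have h : √(2 * π) * √(2 * π) = 2 * π := mul_self_sqrt (by positivity)
      rw [ENNReal.toReal_mul, toReal_gaussianPDF, toReal_gaussianPDF, gaussianPDFReal,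
        gaussianPDFReal]
      simp only [NNReal.coe_one, mul_one, sub_zero]
      rw [mul_mul_mul_comm, ← mul_inv, h, ← exp_add]
      congr 2
      ring
    rw [gaussianReal_of_var_ne_zero 0 one_ne_zero,
      prod_withDensity₀ (by fun_prop) (by fun_prop), ← Measure.volume_eq_prod,
      integral_withDensity_eq_integral_toReal_smul (by fun_prop)
        (ae_of_all _ fun p => ENNReal.mul_lt_top gaussianPDF_lt_top gaussianPDF_lt_top),
      ← integral_comp_polarCoord_symm]
    simp only [hdens]
    rw [intervalIntegral.integral_of_le (by linarith [pi_pos]), integral_Ioc_eq_integral_Ioo,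
      ← setIntegral_prod_mul, ← Measure.volume_eq_prod]
    refine setIntegral_congr_fun polarCoord.open_target.measurableSet fun p hp => ?_
    have hp1 : 0 < p.1 := hp.1
    simp only [polarCoord_symm_apply, smul_eq_mul]
    rw [hF _ hp1, mul_pow, mul_pow, ← mul_add, cos_sq_add_sin_sq, mul_one]
    ring
  -- The radial integral is read off from the case `F = 1`.
  have h1 := polar (fun _ => 1) (fun _ _ _ _ => rfl)
  have hπ := pi_pos
  have hC : (∫ r in Set.Ioi (0 : ℝ), r * ((2 * π)⁻¹ * exp (-r ^ 2 / 2))) = (2 * π)⁻¹ := by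
    simp only [integral_const, probReal_univ, smul_eq_mul, mul_one,
      intervalIntegral.integral_const] at h1
    field_simp at h1 ⊢
    linarith
  rw [polar F hF, hC]

theorem integral_hardSign_cos_mul_hardSign_cos {φ : ℝ} (h0 : 0 ≤ φ) (hπ : φ ≤ π) :
    ∫ θ in (-π)..π, hardSign (cos θ) * hardSign (cos (θ - φ)) = 2 * π - 4 * φ := by
  set F : ℝ → ℝ := fun θ => hardSign (cos θ) * hardSign (cos (θ - φ)) with hFdef
  have hper : Function.Periodic F (2 * π) := by
    intro θ
    simp only [hFdef]
    rw [cos_add_two_pi, show θ + 2 * π - φ = θ - φ + 2 * π by ring, cos_add_two_pi]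
  have hint : ∀ a b : ℝ, IntervalIntegrable F volume a b := by
    intro a b
    refine (intervalIntegrable_const (c := (1 : ℝ))).mono_fun
      (Measurable.aestronglyMeasurable (by fun_prop)) (ae_of_all _ fun θ => ?_)
    rcases hardSign_eq (cos θ) with h | h <;> rcases hardSign_eq (cos (θ - φ)) with h' | h' <;>
      simp [hFdef, h, h']
  have hshift := hper.intervalIntegral_add_eq (-π) (-(π / 2))
  rw [show -π + 2 * π = π by ring, show -(π / 2) + 2 * π = π + π / 2 by ring] at hshift
  rw [hshift]
  have pos : ∀ θ, -(π / 2) < θ → θ < π / 2 → hardSign (cos θ) = 1 := fun θ h1 h2 =>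
    hardSign_of_nonneg (cos_pos_of_mem_Ioo ⟨h1, h2⟩).le
  have neg : ∀ θ, π / 2 < θ → θ < π + π / 2 → hardSign (cos θ) = -1 := fun θ h1 h2 =>
    hardSign_of_neg (cos_neg_of_pi_div_two_lt_of_lt h1 h2)
  have neg' : ∀ θ, -(π + π / 2) < θ → θ < -(π / 2) → hardSign (cos θ) = -1 := fun θ h1 h2 => by
    rw [← cos_neg]; exact neg _ (by linarith) (by linarith)
  have piece : ∀ a b c : ℝ, a ≤ b → (∀ θ ∈ Set.Ioo a b, F θ = c) →
      ∫ θ in a..b, F θ = (b - a) * c := by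
    intro a b c hab h
    rw [intervalIntegral.integral_congr_Ioo_of_le (g := fun _ => c) hab h]
    simp
  rw [← intervalIntegral.integral_add_adjacent_intervals (hint _ (φ - π / 2)) (hint _ _),
    ← intervalIntegral.integral_add_adjacent_intervals (hint (φ - π / 2) (π / 2)) (hint _ _),
    ← intervalIntegral.integral_add_adjacent_intervals (hint (π / 2) (φ + π / 2)) (hint _ _),
    piece (-(π / 2)) (φ - π / 2) (-1) (by linarith), piece (φ - π / 2) (π / 2) 1 (by linarith),
    piece (π / 2) (φ + π / 2) (-1) (by linarith), piece (φ + π / 2) (π + π / 2) 1 (by linarith)]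
  · ring
  · rintro θ ⟨h1, h2⟩
    simp only [hFdef]
    rw [neg θ (by linarith) (by linarith), neg (θ - φ) (by linarith) (by linarith)]; norm_num
  · rintro θ ⟨h1, h2⟩
    simp only [hFdef]
    rw [neg θ (by linarith) (by linarith), pos (θ - φ) (by linarith) (by linarith)]; norm_num
  · rintro θ ⟨h1, h2⟩
    simp only [hFdef]
    rw [pos θ (by linarith) (by linarith), pos (θ - φ) (by linarith) (by linarith)]; norm_num
  · rintro θ ⟨h1, h2⟩
    simp only [hFdef]
    rw [pos θ (by linarith) (by linarith), neg' (θ - φ) (by linarith) (by linarith)]; norm_num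

section Joint

variable {E F : Type*} [NormedAddCommGroup E] [InnerProductSpace ℝ E] [FiniteDimensional ℝ E]
  [MeasurableSpace E] [BorelSpace E] [NormedAddCommGroup F] [InnerProductSpace ℝ F]
  [FiniteDimensional ℝ F] [MeasurableSpace F] [BorelSpace F]

theorem charFunDual_map_inner_prod_stdGaussian (a b : E) (L : StrongDual ℝ (ℝ × ℝ)) :
    charFunDual ((stdGaussian E).map (fun x => (inner ℝ a x, inner ℝ b x))) L =
      Complex.exp (-((L (1, 0)) ^ 2 * ‖a‖ ^ 2 + 2 * (L (1, 0) * L (0, 1) * inner ℝ a b) +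
        (L (0, 1)) ^ 2 * ‖b‖ ^ 2 : ℝ) / 2) := by
  have h : charFunDual ((stdGaussian E).map ((innerSL ℝ a).prod (innerSL ℝ b))) L = _ :=
    charFunDual_map _ L
  have hL : L.comp ((innerSL ℝ a).prod (innerSL ℝ b)) =
      innerSL ℝ (L (1, 0) • a + L (0, 1) • b) := by
    ext x
    have hx : ((inner ℝ a x, inner ℝ b x) : ℝ × ℝ) =
        inner ℝ a x • (1, 0) + inner ℝ b x • (0, 1) := by simp
    simp only [ContinuousLinearMap.comp_apply, ContinuousLinearMap.prod_apply,
      innerSL_apply_apply]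
    rw [hx, map_add, map_smul, map_smul, inner_add_left, real_inner_smul_left,
      real_inner_smul_left]
    simp [mul_comm]
  rw [hL, charFunDual_stdGaussian, innerSL_apply_norm] at h
  refine h.trans ?_
  rw [← Complex.ofReal_pow, norm_add_sq_real, norm_smul, norm_smul, real_inner_smul_left,
    real_inner_smul_right, mul_pow, mul_pow, norm_eq_abs, norm_eq_abs, sq_abs, sq_abs]
  congr 3
  push_cast
  ring

/-- The joint law of two linear functionals of a standard Gaussian vector only depends on their
Gram matrix. -/
theorem map_inner_prod_stdGaussian_congr {a b : E} {a' b' : F} (haa : ‖a‖ = ‖a'‖)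
    (hbb : ‖b‖ = ‖b'‖) (hab : inner ℝ a b = inner ℝ a' b') :
    (stdGaussian E).map (fun x => (inner ℝ a x, inner ℝ b x)) =
      (stdGaussian F).map (fun x => (inner ℝ a' x, inner ℝ b' x)) := by
  have : IsProbabilityMeasure ((stdGaussian E).map (fun x => (inner ℝ a x, inner ℝ b x))) :=
    Measure.isProbabilityMeasure_map (by fun_prop)
  have : IsProbabilityMeasure ((stdGaussian F).map (fun x => (inner ℝ a' x, inner ℝ b' x))) :=
    Measure.isProbabilityMeasure_map (by fun_prop)
  refine Measure.ext_of_charFunDual ?_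
  ext L
  rw [charFunDual_map_inner_prod_stdGaussian, charFunDual_map_inner_prod_stdGaussian, haa, hbb, hab]

/-- **Grothendieck's identity**: the signs of two jointly Gaussian variables with correlation `ρ`
have correlation `(2 / π) arcsin ρ`. -/
theorem integral_hardSign_inner_mul_hardSign_inner {a b : E} (ha : ‖a‖ = 1) (hb : ‖b‖ = 1) :
    ∫ x, hardSign (inner ℝ a x) * hardSign (inner ℝ b x) ∂(stdGaussian E) =
      2 / π * arcsin (inner ℝ a b) := by
  set φ := arccos (inner ℝ a b) with hφ
  have hab := abs_le.1 (abs_real_inner_le_norm a b)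
  rw [ha, hb, one_mul] at hab
  have hcos : cos φ = inner ℝ a b := cos_arccos hab.1 hab.2
  let a' : EuclideanSpace ℝ (Fin 2) := !₂[1, 0]
  let b' : EuclideanSpace ℝ (Fin 2) := !₂[cos φ, sin φ]
  have ha' : ‖a'‖ = 1 := by simp [a', EuclideanSpace.norm_eq]
  have hb' : ‖b'‖ = 1 := by simp [b', EuclideanSpace.norm_eq]
  have hab' : inner ℝ a' b' = inner ℝ a b := by
    simp [a', b', hcos, PiLp.inner_apply, Fin.sum_univ_two]
  have hmap := map_inner_prod_stdGaussian_congr (ha.trans ha'.symm) (hb.trans hb'.symm) hab'.symm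
  let f : ℝ × ℝ → ℝ := fun p => hardSign p.1 * hardSign p.2
  have hf : Measurable f := by fun_prop
  have e1 := integral_map (μ := stdGaussian E) (φ := fun x => (inner ℝ a x, inner ℝ b x)) (f := f)
    (by fun_prop) hf.aestronglyMeasurable
  have e2 := integral_map (μ := stdGaussian (EuclideanSpace ℝ (Fin 2)))
    (φ := fun x => (inner ℝ a' x, inner ℝ b' x)) (f := f)
    (by fun_prop) hf.aestronglyMeasurable
  rw [← hmap] at e2
  have e3 : ∫ x, f (inner ℝ a' x, inner ℝ b' x) ∂(stdGaussian (EuclideanSpace ℝ (Fin 2))) =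
      ∫ p, hardSign p.1 * hardSign (cos φ * p.1 + sin φ * p.2)
        ∂((gaussianReal 0 1).prod (gaussianReal 0 1)) := by
    rw [← map_pi_eq_stdGaussian, integral_map (by fun_prop)
      (Measurable.aestronglyMeasurable (by fun_prop)),
      ← (measurePreserving_finTwoArrow (gaussianReal 0 1)).integral_comp'
        (g := fun p : ℝ × ℝ => hardSign p.1 * hardSign (cos φ * p.1 + sin φ * p.2))]
    refine integral_congr_ae (ae_of_all _ fun x => ?_)
    simp [f, a', b', PiLp.inner_apply, Fin.sum_univ_two, mul_comm]
  have e4 := integral_gaussian_prod_of_homogeneous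
    (F := fun p => hardSign p.1 * hardSign (cos φ * p.1 + sin φ * p.2)) (fun r hr x y => by
      dsimp only
      rw [hardSign_mul_of_pos hr, show cos φ * (r * x) + sin φ * (r * y) =
        r * (cos φ * x + sin φ * y) by ring, hardSign_mul_of_pos hr])
  have e5 := integral_hardSign_cos_mul_hardSign_cos (arccos_nonneg (inner ℝ a b))
    (arccos_le_pi (inner ℝ a b))
  rw [← hφ] at e5
  have e6 : ∀ θ, cos φ * cos θ + sin φ * sin θ = cos (θ - φ) := fun θ => by
    rw [cos_sub]; ring
  simp only [e6, e5] at e4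
  change ∫ x, f (inner ℝ a x, inner ℝ b x) ∂(stdGaussian E) = _
  rw [← e1, e2, e3, e4, hφ, arccos_eq_pi_div_two_sub_arcsin]
  field_simp
  ring

end Joint

end

section

/-! ### Krivine's bound -/

open ProbabilityTheory Real Matrix

open scoped MatrixOrder Matrix.Norms.L2Operator in
theorem exists_gram_eq_of_posSemidef {ι : Type*} [Fintype ι] {M : Matrix ι ι ℝ}
    (hM : M.PosSemidef) :
    ∃ w : ι → EuclideanSpace ℝ ι, ∀ i j, inner ℝ (w i) (w j) = M i j := by
  classical
  obtain ⟨B, hB⟩ := CStarAlgebra.nonneg_iff_eq_star_mul_self.mp hM.nonneg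
  refine ⟨fun i => WithLp.toLp 2 fun k => B k i, fun i j => ?_⟩
  rw [hB, star_eq_conjTranspose, mul_apply]
  simp [PiLp.inner_apply, mul_comm]

theorem posSemidef_of_hasSum {ι : Type*} [Fintype ι] {A : ℕ → Matrix ι ι ℝ} {M : Matrix ι ι ℝ}
    (hA : ∀ k, (A k).PosSemidef) (hM : ∀ i j, HasSum (fun k => A k i j) (M i j)) :
    M.PosSemidef := by
  refine PosSemidef.of_dotProduct_mulVec_nonneg ?_ fun x => ?_
  · ext i j
    refine (hM j i).unique ?_
    convert hM i j using 2 with k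
    exact (hA k).isHermitian.apply i j
  · have h : HasSum (fun k => star x ⬝ᵥ (A k *ᵥ x)) (star x ⬝ᵥ (M *ᵥ x)) :=
      hasSum_sum fun i _ => (hasSum_sum fun j _ => (hM i j).mul_right _).mul_left _
    exact h.nonneg fun k => (hA k).dotProduct_mulVec_nonneg x

theorem posSemidef_hadamard_pow {ι : Type*} [Finite ι] {M : Matrix ι ι ℝ} (hM : M.PosSemidef)
    (n : ℕ) : (of fun i j => M i j ^ n : Matrix ι ι ℝ).PosSemidef := by
  classical
  cases nonempty_fintype ι
  induction n with
  | zero =>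
    convert posSemidef_vecMulVec_self_star (fun _ : ι => (1 : ℝ)) using 1
    ext i j
    simp [vecMulVec_apply]
  | succ n ih =>
    have h : (of fun i j => M i j ^ (n + 1) : Matrix ι ι ℝ) = (of fun i j => M i j ^ n) ⊙ M := by
      ext i j
      simp [pow_succ]
    rw [h]
    exact ih.hadamard hM

/-- The kernel that is `sinh (c ⟪·, ·⟫)` within each of two families of vectors and
`sin (c ⟪·, ·⟫)` across them is positive semidefinite: in its expansion into odd powers, the sign
`(-1) ^ k` of the sine series only flips the `k`-th power on the cross blocks, which is the Schur
product with a matrix of rank one. -/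
theorem posSemidef_sinh_sin {ι H : Type*} [Finite ι] [NormedAddCommGroup H]
    [InnerProductSpace ℝ H] (W : ι → H) (ε : ι → ℝ) {c : ℝ} (hc : 0 ≤ c)
    (hε : ∀ i, ε i = 1 ∨ ε i = -1) :
    (of fun i j => if ε i = ε j then sinh (c * inner ℝ (W i) (W j))
      else sin (c * inner ℝ (W i) (W j)) : Matrix ι ι ℝ).PosSemidef := by
  cases nonempty_fintype ι
  let A : ℕ → Matrix ι ι ℝ := fun k => (c ^ (2 * k + 1) / (2 * k + 1).factorial) •
    (vecMulVec (fun i => ε i ^ k) (star fun i => ε i ^ k) ⊙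
      of fun i j => (gram ℝ W) i j ^ (2 * k + 1))
  refine posSemidef_of_hasSum (A := A) (fun k => ?_) fun i j => ?_
  · exact ((posSemidef_vecMulVec_self_star _).hadamard
      (posSemidef_hadamard_pow (posSemidef_gram ℝ W) _)).smul (by positivity)
  · have hA : ∀ k, A k i j = (ε i * ε j) ^ k * (c * inner ℝ (W i) (W j)) ^ (2 * k + 1) /
        (2 * k + 1).factorial := by
      intro k
      simp only [A, Matrix.smul_apply, hadamard_apply, vecMulVec_apply, of_apply, gram_apply,
        star_trivial, smul_eq_mul, mul_pow]
      ring
    simp only [hA, of_apply]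
    split_ifs with h
    · have : ε i * ε j = 1 := by rcases hε i with hi | hi <;> simp [← h, hi]
      simpa [this] using hasSum_sinh (c * inner ℝ (W i) (W j))
    · have : ε i * ε j = -1 := by
        rcases hε i with hi | hi <;> rcases hε j with hj | hj <;> simp_all
      simpa [this] using hasSum_sin (c * inner ℝ (W i) (W j))

theorem arsinh_one_pos : 0 < arsinh 1 := arsinh_pos_iff.2 one_pos

theorem arsinh_one_le_one : arsinh 1 ≤ 1 := by
  rw [← sinh_le_sinh, sinh_arsinh]
  exact self_le_sinh_iff.2 zero_le_one

theorem krivineConstant_pos : 0 < krivineConstant := by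
  have := arsinh_one_pos
  unfold krivineConstant
  positivity

/-- Krivine's argument: Gaussian rounding of unit vectors with inner products `sin (c ⟪U x, V y⟫)`,
where `c = arsinh 1`, has incidences `(2 c / π) ⟪U x, V y⟫`. -/
theorem inner_div_krivineConstant_mem_convIncidence_of_fintype {S : Type u} {T : Type v} [Finite S]
    [Finite T] {H : Type*} [NormedAddCommGroup H] [InnerProductSpace ℝ H] {U : S → H} {V : T → H}
    (hU : ∀ x, ‖U x‖ ^ 2 ≤ 1) (hV : ∀ y, ‖V y‖ ^ 2 ≤ 1) :
    (fun x y => inner ℝ (U x) (V y) / krivineConstant) ∈ convIncidence (Fin 2) S T := by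
  classical
  cases nonempty_fintype S
  cases nonempty_fintype T
  set c := arsinh 1 with hcdef
  have hc : 0 < c := arsinh_one_pos
  let W : S ⊕ T → H := Sum.elim U V
  have hW : ∀ i, ‖W i‖ ^ 2 ≤ 1 := by rintro (x | y); exacts [hU x, hV y]
  let M := (of fun i j => if Sum.elim (fun _ => 1) (fun _ => -1) i =
        (Sum.elim (fun _ => 1) (fun _ => -1) j : ℝ) then sinh (c * inner ℝ (W i) (W j))
      else sin (c * inner ℝ (W i) (W j)) : Matrix (S ⊕ T) (S ⊕ T) ℝ)
  have hM : M.PosSemidef := posSemidef_sinh_sin W _ hc.le (by rintro (x | y) <;> simp)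
  -- Within one family `M` has diagonal `sinh (c ‖W i‖²) ≤ sinh c = 1`.
  have hMd : ∀ i, M i i ≤ 1 := by
    intro i
    have h1 : M i i = sinh (c * ‖W i‖ ^ 2) := by simp [M]
    rw [h1, ← sinh_arsinh 1, sinh_le_sinh, ← hcdef]
    nlinarith [hW i]
  -- Extra mass on the diagonal makes the vectors unit vectors.
  have hD : (diagonal fun i => 1 - M i i).PosSemidef :=
    PosSemidef.diagonal fun i => sub_nonneg.2 (hMd i)
  obtain ⟨w, hw⟩ := exists_gram_eq_of_posSemidef (hM.add hD)
  have hw1 : ∀ i, ‖w i‖ = 1 := by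
    intro i
    have : ‖w i‖ ^ 2 = 1 := by rw [← real_inner_self_eq_norm_sq, hw]; simp
    exact (pow_eq_one_iff_of_nonneg (norm_nonneg _) two_ne_zero).1 this
  have h := integral_sign_mul_mem_convIncidence (S := S) (T := T)
    (stdGaussian (EuclideanSpace ℝ (S ⊕ T)))
    (f := fun z x => hardSign (inner ℝ (w (Sum.inl x)) z))
    (g := fun z y => hardSign (inner ℝ (w (Sum.inr y)) z)) (fun x => by fun_prop)
    (fun y => by fun_prop) (fun z x => hardSign_eq _) (fun z y => hardSign_eq _)
  convert h using 1
  funext x y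
  have hxy : inner ℝ (w (Sum.inl x)) (w (Sum.inr y)) = sin (c * inner ℝ (U x) (V y)) := by
    rw [hw]
    simp only [Matrix.add_apply, ne_eq, reduceCtorEq, not_false_eq_true, diagonal_apply_ne,
      add_zero, M, of_apply, Sum.elim_inl, Sum.elim_inr, W]
    exact if_neg (by norm_num)
  -- `|c ⟪U x, V y⟫| ≤ 1 ≤ π / 2`, so that `arcsin` undoes `sin`.
  have hle : |c * inner ℝ (U x) (V y)| ≤ 1 := by
    have h1 := abs_real_inner_le_norm (U x) (V y)
    have h2 : ‖U x‖ ≤ 1 := by nlinarith [hU x, norm_nonneg (U x)]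
    have h3 : ‖V y‖ ≤ 1 := by nlinarith [hV y, norm_nonneg (V y)]
    have h4 : |inner ℝ (U x) (V y)| ≤ 1 := h1.trans (mul_le_one₀ h2 (norm_nonneg _) h3)
    rw [abs_mul, abs_of_pos hc]
    exact mul_le_one₀ arsinh_one_le_one (abs_nonneg _) h4
  have hle' := abs_le.1 hle
  have hπ : 1 ≤ π / 2 := by linarith [two_le_pi]
  rw [integral_hardSign_inner_mul_hardSign_inner (hw1 _) (hw1 _), hxy,
    arcsin_sin (by linarith) (by linarith), krivineConstant, ← hcdef]
  field_simp

theorem inner_div_krivineConstant_mem_convIncidence {S : Type u} {T : Type v} {H : Type*}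
    [NormedAddCommGroup H] [InnerProductSpace ℝ H] {U : S → H} {V : T → H}
    (hU : ∀ x, ‖U x‖ ^ 2 ≤ 1) (hV : ∀ y, ‖V y‖ ^ 2 ≤ 1) :
    (fun x y => inner ℝ (U x) (V y) / krivineConstant) ∈ convIncidence (Fin 2) S T :=
  mem_convIncidence_two_of_finset fun F G =>
    inner_div_krivineConstant_mem_convIncidence_of_fintype (fun x : F => hU x) fun y : G => hV y

theorem krivineConstant_le : krivineConstant ≤ 1.79 := by
  have h : 0.878 ≤ arsinh 1 := by
    rw [← sinh_le_sinh, sinh_arsinh, sinh_eq]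
    have h1 : exp 0.878 ≤ 2.4065 := by
      have := exp_bound' (x := 0.878) (by norm_num) (by norm_num) (n := 8) (by norm_num)
      refine this.trans ?_
      norm_num [Finset.sum_range_succ, Nat.factorial]
    have h2 : 1 / 2.4065 ≤ exp (-0.878) := by
      rw [exp_neg, ← one_div]
      exact one_div_le_one_div_of_le (exp_pos _) h1
    norm_num at h1 h2 ⊢
    linarith
  unfold krivineConstant
  rw [div_le_iff₀ (by linarith)]
  have := pi_lt_d4
  norm_num at *
  linarith

end

section

/-! ### A one-dimensional Gaussian optimization -/

open ProbabilityTheory Real Filter Topology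

/-- The mean excess of `b |t|` over the level `l`, for a standard Gaussian variable `t`. -/
def meanExcess (l b : ℝ) : ℝ := ∫ t, max (b * |t| - l) 0 ∂(gaussianReal 0 1)

theorem integral_abs_gaussianReal (F : ℝ → ℝ) :
    ∫ t, F |t| ∂(gaussianReal 0 1) = ∫ s in Set.Ioi 0, √(2 / π) * exp (-s ^ 2 / 2) * F s := by
  rw [integral_gaussianReal_eq_integral_smul one_ne_zero]
  have h := integral_comp_abs (f := fun s => gaussianPDFReal 0 1 s * F s)
  have hc : 2 * (√(2 * π))⁻¹ = √(2 / π) := by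
    rw [sqrt_div zero_le_two, sqrt_mul zero_le_two, mul_inv, ← mul_assoc,
      show (2 : ℝ) * (√2)⁻¹ = √2 by rw [← div_eq_mul_inv, div_sqrt], div_eq_mul_inv]
  calc ∫ t, gaussianPDFReal 0 1 t • F |t| = ∫ t, gaussianPDFReal 0 1 |t| * F |t| := by
        simp [gaussianPDFReal, sq_abs]
    _ = 2 * ∫ s in Set.Ioi 0, gaussianPDFReal 0 1 s * F s := h
    _ = _ := by
      rw [← integral_const_mul]
      refine setIntegral_congr_fun measurableSet_Ioi fun s _ => ?_
      simp only [gaussianPDFReal, ← hc, NNReal.coe_one, mul_one, sub_zero]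
      ring

theorem meanExcess_eq {l b : ℝ} (hl : 0 ≤ l) (hb : 0 < b) :
    meanExcess l b = b * (√(2 / π) * exp (-(l / b) ^ 2 / 2)) -
      l * (1 - √(2 / π) * ∫ s in (0 : ℝ)..(l / b), exp (-s ^ 2 / 2)) := by
  set κ := √(2 / π) with hκ
  have hκ0 : 0 ≤ κ := sqrt_nonneg _
  have hc : 0 ≤ l / b := by positivity
  have hcont : Continuous fun s : ℝ => exp (-s ^ 2 / 2) := by fun_prop
  have htot : κ * ∫ s in Set.Ioi (0 : ℝ), exp (-s ^ 2 / 2) = 1 := by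
    have h := integral_abs_gaussianReal fun _ => 1
    simp only [integral_const, probReal_univ, smul_eq_mul, mul_one] at h
    rw [h, integral_const_mul]
  have hint : IntegrableOn (fun s : ℝ => exp (-s ^ 2 / 2)) (Set.Ioi 0) := by
    have := (integrable_exp_neg_mul_sq (b := 1 / 2) (by norm_num)).integrableOn (s := Set.Ioi 0)
    refine this.congr_fun (fun s _ => ?_) measurableSet_Ioi
    dsimp only
    congr 1
    ring
  -- An antiderivative of the integrand `(b s - l)` against the density of `|t|`.
  let Ψ : ℝ → ℝ := fun s =>
    -(b * (κ * exp (-s ^ 2 / 2))) - l * (κ * ∫ u in (0 : ℝ)..s, exp (-u ^ 2 / 2))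
  have hderiv : ∀ s, HasDerivAt Ψ (κ * exp (-s ^ 2 / 2) * (b * s - l)) s := by
    intro s
    have h1 : HasDerivAt (fun s : ℝ => -s ^ 2 / 2) (-s) s := by
      refine ((hasDerivAt_pow 2 s).neg.div_const 2).congr_deriv ?_
      simp only [Nat.cast_ofNat, Nat.add_one_sub_one, pow_one]
      ring
    have h2 := ((h1.exp.const_mul κ).const_mul b).neg
    have h3 := (((hcont.integral_hasStrictDerivAt 0 s).hasDerivAt).const_mul κ).const_mul l
    refine (h2.sub h3).congr_deriv ?_
    ring
  have hlim : Tendsto Ψ atTop (𝓝 (-(b * (κ * 0)) - l * 1)) := by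
    refine Tendsto.sub (Tendsto.neg (Tendsto.const_mul _ (Tendsto.const_mul _ ?_)))
      (Tendsto.const_mul _ ?_)
    · refine tendsto_exp_atBot.comp ?_
      have : Tendsto (fun s : ℝ => s ^ 2 / 2) atTop atTop :=
        (tendsto_pow_atTop two_ne_zero).atTop_div_const zero_lt_two
      refine (tendsto_neg_atTop_atBot.comp this).congr fun s => ?_
      simp [neg_div]
    · rw [← htot]
      exact (intervalIntegral_tendsto_integral_Ioi 0 hint tendsto_id).const_mul κ
  have hmain := integral_Ioi_of_hasDerivAt_of_nonneg' (a := l / b) (fun s _ => hderiv s)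
    (fun s hs => by
      have : l < b * s := by
        have := (div_lt_iff₀ hb).1 (Set.mem_Ioi.1 hs)
        linarith
      have h2 : 0 ≤ b * s - l := by linarith
      positivity) hlim
  have hsplit : meanExcess l b = ∫ s in Set.Ioi (l / b), κ * exp (-s ^ 2 / 2) * (b * s - l) := by
    rw [meanExcess, integral_abs_gaussianReal fun s => max (b * s - l) 0]
    refine (setIntegral_eq_of_subset_of_forall_sdiff_eq_zero measurableSet_Ioi
      (Set.Ioi_subset_Ioi hc) ?_).trans ?_
    rotate_left
    · refine setIntegral_congr_fun measurableSet_Ioi fun s hs => ?_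
      have := (div_lt_iff₀ hb).1 (Set.mem_Ioi.1 hs)
      rw [max_eq_left (by linarith)]
    · rintro s ⟨-, hs⟩
      have := (le_div_iff₀ hb).1 (not_lt.1 hs)
      rw [max_eq_right (by linarith), mul_zero]
  rw [hsplit, hmain]
  simp only [Ψ]
  ring

theorem hasDerivAt_meanExcess {l b : ℝ} (hl : 0 ≤ l) (hb : 0 < b) :
    HasDerivAt (meanExcess l) (√(2 / π) * exp (-(l / b) ^ 2 / 2)) b := by
  have hcont : Continuous fun s : ℝ => exp (-s ^ 2 / 2) := by fun_prop
  have h0 : HasDerivAt (fun b : ℝ => l / b) (-l / b ^ 2) b := by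
    refine ((hasDerivAt_inv hb.ne').const_mul l).congr_deriv ?_
    field_simp
  have h1 : HasDerivAt (fun b : ℝ => -(l / b) ^ 2 / 2) (-(l / b) * (-l / b ^ 2)) b := by
    refine ((h0.pow 2).neg.div_const 2).congr_deriv ?_
    simp
    ring
  have h2 := (hasDerivAt_id b).mul (h1.exp.const_mul √(2 / π))
  have h3 := ((((hcont.integral_hasStrictDerivAt 0 (l / b)).hasDerivAt.comp b h0).const_mul
    √(2 / π)).const_sub 1).const_mul l
  refine ((h2.sub h3).congr_deriv ?_).congr_of_eventuallyEq ?_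
  · simp only [id]
    field_simp
    ring
  · filter_upwards [lt_mem_nhds hb] with b hb
    simp only [Pi.sub_apply, Pi.mul_apply, Function.comp_apply, id]
    exact meanExcess_eq hl hb

theorem meanExcess_le {l b : ℝ} (hl : 0 ≤ l) (hb : 0 < b) : meanExcess l b ≤ b * √(2 / π) := by
  have h0 := meanExcess_eq le_rfl hb
  simp only [zero_div, intervalIntegral.integral_same, ne_eq, OfNat.ofNat_ne_zero,
    not_false_eq_true, zero_pow, neg_zero, exp_zero, mul_one, zero_mul, sub_zero] at h0
  rw [← h0]
  have hint : ∀ l, Integrable (fun t : ℝ => max (b * |t| - l) 0) (gaussianReal 0 1) := fun l => by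
    have : Integrable (fun t : ℝ => t) (gaussianReal 0 1) := IsGaussian.integrable_id
    exact ((this.abs.const_mul b).sub (integrable_const l)).pos_part
  refine integral_mono (hint l) (hint 0) fun t => max_le_max_right _ (by linarith)

/-- The optimal norm of the barycentre in the lower bound for Grothendieck's constant. -/
def optNorm : ℝ := √(2 / π) * exp (-(1 / 4) ^ 2 / 2)

theorem optNorm_pos : 0 < optNorm := by
  have := pi_pos
  unfold optNorm
  positivity

theorem sqrt_two_div_pi_le : √(2 / π) ≤ 0.798 := by
  rw [sqrt_le_left (by norm_num), div_le_iff₀ pi_pos]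
  have := pi_gt_d4
  norm_num at *
  linarith

theorem optNorm_le : optNorm ≤ 0.774 := by
  have h1 : optNorm ^ 2 = 2 / π * exp (-(1 / 16)) := by
    rw [optNorm, mul_pow, sq_sqrt (by have := pi_pos; positivity), ← exp_nat_mul]
    norm_num
  have h2 : exp (-(1 / 16)) ≤ 0.94 := by
    rw [exp_neg, inv_le_comm₀ (exp_pos _) (by norm_num)]
    refine le_trans ?_ (quadratic_le_exp_of_nonneg (by norm_num))
    norm_num
  have h3 : 2 / π ≤ 0.6368 := by
    rw [div_le_iff₀ pi_pos]
    have := pi_gt_d4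
    norm_num at *
    linarith
  refine le_of_sq_le_sq ?_ (by norm_num)
  rw [h1]
  calc 2 / π * exp (-(1 / 16)) ≤ 0.6368 * 0.94 := by gcongr
    _ ≤ _ := by norm_num

/-- Among all norms `b` of the barycentre, the value `l + 2 E (b |t| - l)⁺ - b²`, with
`l = a / 4`, is largest at `b = a`, where it is `a² - l (1 - 2 P (|t| < 1/4))`. Here
`a = E |t| 1_{|t| > 1/4}`, which makes `a` a critical point. The right-hand side `1 - l` is the
limit of the values of the same form on unit vectors. -/
theorem meanExcess_bound {b : ℝ} (hb : 0 ≤ b) :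
    1.67 * (optNorm / 4 + 2 * meanExcess (optNorm / 4) b - b ^ 2) ≤ 1 - optNorm / 4 := by
  set a := optNorm with hadef
  have ha : 0 < a := optNorm_pos
  have ha1 : a ≤ 0.774 := optNorm_le
  set κ := √(2 / π) with hκ
  have hκ0 : 0 ≤ κ := sqrt_nonneg _
  have hκ1 : κ ≤ 0.798 := sqrt_two_div_pi_le
  have haκ : a = κ * exp (-(1 / 4) ^ 2 / 2) := rfl
  set l := a / 4 with hl
  have hl0 : 0 ≤ l := by positivity
  let G : ℝ → ℝ := fun b => 2 * meanExcess l b - b ^ 2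
  have hG : ∀ b, 0 < b → HasDerivAt G (2 * (κ * exp (-(l / b) ^ 2 / 2)) - 2 * b) b := by
    intro b hb
    refine (((hasDerivAt_meanExcess hl0 hb).const_mul 2).sub (hasDerivAt_pow 2 b)).congr_deriv ?_
    simp [hκ]
  -- With `b = r a`, the sign of the derivative is that of `exp ((1 - r⁻²) / 32) - r`.
  have hκr : ∀ r, 0 < r →
      κ * exp (-(l / (r * a)) ^ 2 / 2) = a * exp ((1 - (1 / r) ^ 2) / 32) := by
    intro r hr
    rw [haκ, mul_assoc, ← exp_add, ← haκ, hl]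
    congr 2
    field_simp
    ring
  have hbest : 1.67 * (l + G a) ≤ 1 - l := by
    have h1 : G a = a ^ 2 - 2 * l * (1 - κ * ∫ s in (0 : ℝ)..(1 / 4), exp (-s ^ 2 / 2)) := by
      have hla : l / a = 1 / 4 := by rw [hl]; field_simp
      simp only [G]
      rw [meanExcess_eq hl0 ha, hla, ← hκ, ← haκ]
      ring
    have h2 : ∫ s in (0 : ℝ)..(1 / 4), exp (-s ^ 2 / 2) ≤ 1 / 4 := by
      have hcont : Continuous fun s : ℝ => exp (-s ^ 2 / 2) := by fun_prop
      calc ∫ s in (0 : ℝ)..(1 / 4), exp (-s ^ 2 / 2) ≤ ∫ s in (0 : ℝ)..(1 / 4), (1 : ℝ) :=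
            intervalIntegral.integral_mono_on (by norm_num) (hcont.intervalIntegrable _ _)
              intervalIntegrable_const fun s _ => by
                rw [exp_le_one_iff]; nlinarith [sq_nonneg s]
        _ = 1 / 4 := by simp
    have h3 : κ * ∫ s in (0 : ℝ)..(1 / 4), exp (-s ^ 2 / 2) ≤ 0.798 * (1 / 4) :=
      (mul_le_mul_of_nonneg_left h2 hκ0).trans (mul_le_mul_of_nonneg_right hκ1 (by norm_num))
    have h4 : G a ≤ a ^ 2 - 2 * l * (1 - 0.798 * (1 / 4)) := by
      rw [h1]
      have := mul_le_mul_of_nonneg_left h3 hl0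
      linarith
    rw [hl] at h4 ⊢
    nlinarith
  have key : 1.67 * (l + G b) ≤ 1 - l := by
    -- For small `b` the crude bound `E (b |t| - l)⁺ ≤ b E |t|` suffices.
    rcases le_total b (a / 5) with h5 | h5
    · rcases hb.eq_or_lt with rfl | hb
      · have : meanExcess l 0 = 0 := by simp [meanExcess, hl0]
        simp only [G, this]
        norm_num
        linarith
      · have h1 := meanExcess_le hl0 hb
        have h2 : b * κ ≤ a / 5 * 0.798 := mul_le_mul h5 hκ1 hκ0 (by positivity)
        simp only [G]
        nlinarith [sq_nonneg b]
    · refine le_trans ?_ hbest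
      have hb0 : 0 < b := lt_of_lt_of_le (by positivity) h5
      suffices G b ≤ G a by linarith
      rcases le_total b a with hba | hba
      · have hmono : MonotoneOn G (Set.Icc (a / 5) a) := by
          refine monotoneOn_of_deriv_nonneg (convex_Icc _ _) (fun x hx => ?_) (fun x hx => ?_)
            fun x hx => ?_
          · exact (hG x (by linarith [hx.1])).continuousAt.continuousWithinAt
          · rw [interior_Icc] at hx
            exact (hG x (by linarith [hx.1])).differentiableAt.differentiableWithinAt
          · rw [interior_Icc] at hx
            have hx0 : 0 < x := by linarith [hx.1]
            rw [(hG x hx0).deriv]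
            obtain ⟨r, hr⟩ : ∃ r, x = r * a := ⟨x / a, by field_simp⟩
            have hr0 : 0 < r := by
              by_contra h; nlinarith
            have hr1 : r ≤ 1 := by
              by_contra h; nlinarith [hx.2]
            have hr5 : 1 / 5 ≤ r := by
              by_contra h; nlinarith [hx.1]
            have hexp : r ≤ exp ((1 - (1 / r) ^ 2) / 32) := by
              rw [← log_le_iff_le_exp hr0]
              have h1 := log_le_sub_one_of_pos hr0
              refine h1.trans ?_
              have h2 : (1 - (1 / r) ^ 2) / 32 - (r - 1) =
                  (1 - r) * (32 * r ^ 2 - r - 1) / (32 * r ^ 2) := by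
                field_simp
                ring
              have h3 : 0 ≤ 32 * r ^ 2 - r - 1 := by nlinarith
              have h4 : 0 ≤ (1 - r) * (32 * r ^ 2 - r - 1) / (32 * r ^ 2) :=
                div_nonneg (mul_nonneg (by linarith) h3) (by positivity)
              linarith
            rw [hr, hκr r hr0]
            nlinarith
        exact hmono ⟨h5, hba⟩ ⟨by linarith, le_rfl⟩ hba
      · have hanti : AntitoneOn G (Set.Ici a) := by
          refine antitoneOn_of_deriv_nonpos (convex_Ici _) (fun x hx => ?_) (fun x hx => ?_)
            fun x hx => ?_
          · exact (hG x (ha.trans_le hx)).continuousAt.continuousWithinAt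
          · rw [interior_Ici] at hx
            exact (hG x (ha.trans hx)).differentiableAt.differentiableWithinAt
          · rw [interior_Ici] at hx
            rw [(hG x (ha.trans hx)).deriv]
            obtain ⟨r, hr⟩ : ∃ r, x = r * a := ⟨x / a, by field_simp⟩
            have hr1 : 1 ≤ r := by
              by_contra h; nlinarith [Set.mem_Ioi.1 hx]
            have hr0 : 0 < r := by linarith
            have hexp : exp ((1 - (1 / r) ^ 2) / 32) ≤ r := by
              rw [← le_log_iff_exp_le hr0]
              have h1 := one_sub_inv_le_log_of_pos hr0
              refine le_trans ?_ h1
              have h2 : r⁻¹ ≤ 1 := inv_le_one_of_one_le₀ hr1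
              have h3 : 0 < r⁻¹ := inv_pos.2 hr0
              rw [one_div]
              nlinarith
            rw [hr, hκr r hr0]
            nlinarith
        exact hanti (Set.mem_Ici.2 le_rfl) (Set.mem_Ici.2 hba) hba
  simp only [G] at key
  linarith

end

section

/-! ### Standard Gaussian vectors in high dimension -/

open ProbabilityTheory Real Filter Topology

section Gaussian

variable {E : Type*} [NormedAddCommGroup E] [InnerProductSpace ℝ E] [FiniteDimensional ℝ E]
  [MeasurableSpace E] [BorelSpace E]

theorem integral_comp_inner_stdGaussian (w : E) {F : ℝ → ℝ} (hF : Measurable F) :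
    ∫ x, F (inner ℝ w x) ∂(stdGaussian E) = ∫ t, F (‖w‖ * t) ∂(gaussianReal 0 1) := by
  have h1 : (stdGaussian E).map (fun x => inner ℝ w x) = gaussianReal 0 (‖w‖ ^ 2).toNNReal := by
    have := IsGaussian.map_eq_gaussianReal (μ := stdGaussian E) (innerSL ℝ w)
    rw [integral_strongDual_stdGaussian, variance_dual_stdGaussian, innerSL_apply_norm] at this
    exact this
  have h2 : (gaussianReal 0 1).map (‖w‖ * ·) = gaussianReal 0 (‖w‖ ^ 2).toNNReal := by
    rw [gaussianReal_map_const_mul, mul_zero, mul_one]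
    congr 1
    ext
    simp
  rw [← integral_map (φ := fun x => inner ℝ w x) (by fun_prop) hF.aestronglyMeasurable, h1, ← h2,
    integral_map (by fun_prop) hF.aestronglyMeasurable]

theorem integral_excess_inner_stdGaussian (l : ℝ) (w : E) :
    ∫ x, max (|inner ℝ w x| - l) 0 ∂(stdGaussian E) = meanExcess l ‖w‖ := by
  rw [integral_comp_inner_stdGaussian w (F := fun t => max (|t| - l) 0) (by fun_prop), meanExcess]
  simp [abs_mul]

/-- A finite model of the Gaussian measure, with the given accuracy in mean. -/
theorem exists_simpleFunc_integral_norm_sub_le {δ : ℝ} (hδ : 0 < δ) :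
    ∃ Q : SimpleFunc E E, Integrable (fun x => ‖Q x - x‖) (stdGaussian E) ∧
      ∫ x, ‖Q x - x‖ ∂(stdGaussian E) ≤ δ := by
  have hid : MemLp (fun x : E => x) 1 (stdGaussian E) :=
    memLp_one_iff_integrable.2 IsGaussian.integrable_id
  obtain ⟨Q, hQ, hQ1⟩ := hid.exists_simpleFunc_eLpNorm_sub_lt ENNReal.one_ne_top
    (ε := ENNReal.ofReal δ) (by simpa using hδ)
  have hint : Integrable ((fun x : E => x) - ⇑Q) (stdGaussian E) :=
    memLp_one_iff_integrable.1 (hid.sub hQ1)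
  have hnorm : ∀ x, ‖Q x - x‖ = ‖((fun x : E => x) - ⇑Q) x‖ := fun x => by
    rw [Pi.sub_apply, norm_sub_rev]
  refine ⟨Q, by simpa only [hnorm] using hint.norm, ?_⟩
  simp only [hnorm]
  rw [integral_norm_eq_lintegral_enorm hint.aestronglyMeasurable, ← eLpNorm_one_eq_lintegral_enorm]
  exact ENNReal.toReal_le_of_le_ofReal hδ.le hQ.le

end Gaussian

theorem mul_three_sub_div_two_le_sqrt {r : ℝ} (hr : 0 ≤ r) : r * (3 - r) / 2 ≤ √r := by
  obtain ⟨t, ht, rfl⟩ : ∃ t, 0 ≤ t ∧ r = t ^ 2 := ⟨√r, sqrt_nonneg r, (sq_sqrt hr).symm⟩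
  rw [sqrt_sq ht]
  have h : t - t ^ 2 * (3 - t ^ 2) / 2 = t * (t - 1) ^ 2 * (t + 2) / 2 := by ring
  have : 0 ≤ t * (t - 1) ^ 2 * (t + 2) / 2 := by positivity
  linarith

/-- The norm of a standard Gaussian vector concentrates: its mean is asymptotic to `√n`. -/
theorem sqrt_mul_le_integral_norm_stdGaussian {n : ℕ} (hn : 0 < n) :
    √n * (1 - Var[fun t => t ^ 2; gaussianReal 0 1] / (2 * n)) ≤
      ∫ x, ‖x‖ ∂(stdGaussian (EuclideanSpace ℝ (Fin n))) := by
  set v := Var[fun t => t ^ 2; gaussianReal 0 1] with hv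
  have hn' : (0 : ℝ) < n := Nat.cast_pos.2 hn
  have hsq : MemLp (fun t : ℝ => t ^ 2) 2 (gaussianReal 0 1) := by
    have h4 : MemLp (fun t : ℝ => t) 4 (gaussianReal 0 1) :=
      memLp_id_gaussianReal' 4 (by norm_num)
    have : ENNReal.HolderTriple 4 4 2 := ⟨by
      rw [← ENNReal.toReal_eq_toReal_iff' (by simp) (by simp),
        ENNReal.toReal_add (by simp) (by simp)]
      norm_num⟩
    exact (h4.mul (r := 2) h4).ae_eq (ae_of_all _ fun t => by simp [sq])
  have hone : ∫ t, t ^ 2 ∂(gaussianReal 0 1) = 1 := by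
    have h := variance_eq_sub (memLp_id_gaussianReal' (μ := 0) (v := 1) 2 (by norm_num))
    rw [variance_id_gaussianReal] at h
    simpa using h.symm
  let μ : Measure (Fin n → ℝ) := Measure.pi fun _ => gaussianReal 0 1
  let W : (Fin n → ℝ) → ℝ := ∑ i : Fin n, fun x => (x i) ^ 2
  have hWx : ∀ x, W x = ∑ i, (x i) ^ 2 := fun x => by simp [W]
  have hcoord : ∀ i : Fin n, MemLp (fun x : Fin n → ℝ => (x i) ^ 2) 2 μ := fun i =>
    hsq.comp_measurePreserving (measurePreserving_eval _ i)
  have hW2 : MemLp W 2 μ := memLp_finsetSum' _ fun i _ => hcoord i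
  have hvar : Var[W; μ] = n * v := by
    have := variance_sum_pi (μ := fun _ : Fin n => gaussianReal 0 1)
      (X := fun _ t => t ^ 2) fun _ => hsq
    simpa [W, μ] using this
  have hmean : ∫ x, W x ∂μ = n := by
    simp only [hWx]
    rw [integral_finsetSum _ fun i _ => (hcoord i).integrable (by norm_num)]
    have : ∀ i : Fin n, ∫ x, (x i) ^ 2 ∂μ = 1 := fun i => by
      have h := integral_map (μ := μ) (φ := Function.eval i) (f := fun t : ℝ => t ^ 2)
        (measurable_pi_apply i).aemeasurable (by fun_prop)
      rw [(measurePreserving_eval (fun _ : Fin n => gaussianReal 0 1) i).map_eq, hone] at h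
      exact h.symm
    simp [this]
  have hmean2 : ∫ x, W x ^ 2 ∂μ = n * v + n ^ 2 := by
    have := variance_eq_sub hW2
    rw [hvar, hmean] at this
    simp only [Pi.pow_apply] at this
    linarith
  have hWint : Integrable W μ := hW2.integrable (by norm_num)
  have hWint2 : Integrable (fun x => W x ^ 2) μ := hW2.integrable_sq
  have hW0 : ∀ x, 0 ≤ W x := fun x => by rw [hWx]; positivity
  have hnorm : ∀ x : Fin n → ℝ, ‖WithLp.toLp 2 x‖ = √(W x) := fun x => by
    simp [EuclideanSpace.norm_eq, hWx]
  rw [← map_pi_eq_stdGaussian, integral_map (by fun_prop) (by fun_prop)]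
  -- The test `√r ≥ r (3 - r) / 2` at `r = ‖x‖² / n` involves only moments of `‖x‖²`.
  have hlow : ∀ x, √n * (3 / (2 * n) * W x - 1 / (2 * n ^ 2) * W x ^ 2) ≤
      ‖WithLp.toLp 2 x‖ := by
    intro x
    rw [hnorm, ← mul_div_cancel₀ (W x) hn'.ne', sqrt_mul hn'.le, mul_div_cancel₀ _ hn'.ne']
    refine mul_le_mul_of_nonneg_left (le_trans (le_of_eq ?_) (mul_three_sub_div_two_le_sqrt
      (div_nonneg (hW0 x) hn'.le))) (sqrt_nonneg _)
    field_simp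
  have hint1 : Integrable (fun x => 3 / (2 * (n : ℝ)) * W x) μ := hWint.const_mul _
  have hint2 : Integrable (fun x => 1 / (2 * (n : ℝ) ^ 2) * W x ^ 2) μ := hWint2.const_mul _
  have hint3 : Integrable (fun x : Fin n → ℝ => ‖WithLp.toLp 2 x‖) μ := by
    simp only [hnorm]
    refine (hWint.add (integrable_const 1)).mono'
      (Measurable.aestronglyMeasurable (by simp only [hWx]; fun_prop)) (ae_of_all _ fun x => ?_)
    rw [norm_eq_abs, abs_of_nonneg (sqrt_nonneg _),
      sqrt_le_left (by simpa using by linarith [hW0 x])]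
    simp only [Pi.add_apply]
    nlinarith [hW0 x]
  calc √n * (1 - v / (2 * n))
      = ∫ x, √n * (3 / (2 * n) * W x - 1 / (2 * n ^ 2) * W x ^ 2) ∂μ := by
        rw [integral_const_mul, integral_sub hint1 hint2, integral_const_mul, integral_const_mul,
          hmean, hmean2]
        congr 1
        field_simp
        ring
    _ ≤ ∫ x, ‖WithLp.toLp 2 x‖ ∂μ := integral_mono ((hint1.sub hint2).const_mul _) hint3 hlow

/-! ### The lower bound for Grothendieck's constant -/

/-- `C` is admissible in Grothendieck's inequality. -/
def IsGrothendieckBound (C : ℝ) : Prop :=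
  ∀ (m n : ℕ) (A : Matrix (Fin m) (Fin n) ℝ),
    (∀ (s : Fin m → ℝ) (t : Fin n → ℝ), (∀ i, |s i| ≤ 1) → (∀ j, |t j| ≤ 1) →
      |∑ i, ∑ j, A i j * (s i * t j)| ≤ 1) →
    ∀ (H : Type) [NormedAddCommGroup H] [InnerProductSpace ℝ H] [CompleteSpace H]
      (a : Fin m → H) (b : Fin n → H), (∀ i, ‖a i‖ ≤ 1) → (∀ j, ‖b j‖ ≤ 1) →
      |∑ i, ∑ j, A i j * inner ℝ (a i) (b j)| ≤ C

theorem IsGrothendieckBound.sum_le {C : ℝ} (hC : IsGrothendieckBound C) {ι : Type*} [Fintype ι]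
    {A : ι → ι → ℝ} {B : ℝ} (hB : 0 < B)
    (hA : ∀ s t : ι → ℝ, (∀ i, |s i| ≤ 1) → (∀ j, |t j| ≤ 1) →
      ∑ i, ∑ j, A i j * (s i * t j) ≤ B)
    {H : Type} [NormedAddCommGroup H] [InnerProductSpace ℝ H] [CompleteSpace H] {a : ι → H}
    (ha : ∀ i, ‖a i‖ ≤ 1) : ∑ i, ∑ j, A i j * inner ℝ (a i) (a j) ≤ C * B := by
  let e := Fintype.equivFin ι
  have h := hC _ _ (fun i j => A (e.symm i) (e.symm j) / B) (fun s t hs ht => ?_) H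
    (fun i => a (e.symm i)) (fun i => a (e.symm i)) (fun i => ha _) fun i => ha _
  · have h1 : ∑ i, ∑ j, A (e.symm i) (e.symm j) / B * inner ℝ (a (e.symm i)) (a (e.symm j)) =
        (∑ i, ∑ j, A i j * inner ℝ (a i) (a j)) / B := by
      rw [Finset.sum_div, ← e.symm.sum_comp]
      refine Finset.sum_congr rfl fun i _ => ?_
      rw [Finset.sum_div, ← e.symm.sum_comp]
      exact Finset.sum_congr rfl fun j _ => by ring
    rw [h1] at h
    exact (div_le_iff₀ hB).1 ((le_abs_self _).trans h)
  · have h1 : ∀ s t : Fin (Fintype.card ι) → ℝ,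
        ∑ i, ∑ j, A (e.symm i) (e.symm j) / B * (s i * t j) =
          (∑ i, ∑ j, A i j * (s (e i) * t (e j))) / B := by
      intro s t
      rw [Finset.sum_div, ← e.symm.sum_comp]
      refine Finset.sum_congr rfl fun i _ => ?_
      rw [Finset.sum_div, ← e.symm.sum_comp]
      refine Finset.sum_congr rfl fun j _ => ?_
      simp only [Equiv.apply_symm_apply]
      ring
    have h2 := hA (fun i => s (e i)) (fun i => t (e i)) (fun i => hs _) fun i => ht _
  -- Bounds from one side only suffice, as `s` may be replaced by `-s`.
    have h3 := hA (fun i => -s (e i)) (fun i => t (e i)) (fun i => by simpa using hs _)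
      fun i => ht _
    simp only [neg_mul, mul_neg, Finset.sum_neg_distrib] at h3
    rw [h1, abs_le, le_div_iff₀ hB, div_le_iff₀ hB]
    constructor <;> linarith

section Form

variable {ι : Type*} [Fintype ι] [DecidableEq ι] {n : ℕ} (p : ι → ℝ)
  (X : ι → EuclideanSpace ℝ (Fin n)) (l : ℝ)

/-- The matrix of the bilinear form `⟪E f X, E g X⟫ - l E f g`, for a random vector `X` that takes
the value `X i` with probability `p i`. -/
def barycentreForm (i j : ι) : ℝ := p i * p j * inner ℝ (X i) (X j) - if i = j then l * p i else 0

theorem sum_barycentreForm_mul (F : ι → ι → ℝ) :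
    ∑ i, ∑ j, barycentreForm p X l i j * F i j =
      ∑ i, ∑ j, p i * p j * inner ℝ (X i) (X j) * F i j - l * ∑ i, p i * F i i := by
  simp only [barycentreForm, sub_mul, Finset.sum_sub_distrib, ite_mul, zero_mul,
    Finset.sum_ite_eq, Finset.mem_univ, if_true, Finset.mul_sum, mul_assoc]

/-- Pointwise, `|τ - l f| + τ f ≤ l + 2 (|τ| - l)⁺` for `|f| ≤ 1`. Averaging this over the
projections `τ` on the barycentre `E f X` eliminates `f`. -/
theorem sum_barycentreForm_mul_le (hp : ∀ i, 0 ≤ p i) (hp1 : ∑ i, p i = 1) (hl : 0 ≤ l)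
    {s t : ι → ℝ} (hs : ∀ i, |s i| ≤ 1) (ht : ∀ i, |t i| ≤ 1) :
    ∑ i, ∑ j, barycentreForm p X l i j * (s i * t j) ≤
      l + 2 * ∑ i, p i * max (|inner ℝ (∑ k, (p k * s k) • X k) (X i)| - l) 0 -
        ‖∑ k, (p k * s k) • X k‖ ^ 2 := by
  set w := ∑ k, (p k * s k) • X k with hw
  have hin : ∀ j, ∑ i, p i * s i * inner ℝ (X i) (X j) = inner ℝ w (X j) := fun j => by
    rw [hw, sum_inner]
    exact Finset.sum_congr rfl fun i _ => by rw [real_inner_smul_left]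
  -- The maximum over `|g| ≤ 1` of the left-hand side is `|τ - l f|`.
  have hpt : ∀ τ f g : ℝ, |f| ≤ 1 → |g| ≤ 1 →
      g * (τ - l * f) ≤ l + 2 * max (|τ| - l) 0 - τ * f := by
    intro τ f g hf hg
    have h1 : g * (τ - l * f) ≤ |τ - l * f| := by
      calc g * (τ - l * f) ≤ |g * (τ - l * f)| := le_abs_self _
        _ = |g| * |τ - l * f| := abs_mul _ _
        _ ≤ 1 * |τ - l * f| := mul_le_mul_of_nonneg_right hg (abs_nonneg _)
        _ = _ := one_mul _
    have hf' := abs_le.1 hf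
    have h2 : |τ - l * f| + τ * f ≤ l + 2 * max (|τ| - l) 0 := by
      rcases abs_cases (τ - l * f) with ⟨e1, -⟩ | ⟨e1, -⟩ <;>
        rcases abs_cases τ with ⟨e2, e3⟩ | ⟨e2, e3⟩ <;>
        rcases max_cases (|τ| - l) 0 with ⟨e4, e5⟩ | ⟨e4, e5⟩ <;> rw [e1, e4] <;> rw [e2] at * <;>
        nlinarith
    linarith
  calc ∑ i, ∑ j, barycentreForm p X l i j * (s i * t j)
      = ∑ j, p j * (t j * (inner ℝ w (X j) - l * s j)) := by
        rw [sum_barycentreForm_mul, Finset.sum_comm, Finset.mul_sum, ← Finset.sum_sub_distrib]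
        refine Finset.sum_congr rfl fun j _ => ?_
        rw [← hin, mul_sub, mul_sub, Finset.mul_sum, Finset.mul_sum]
        congr 1
        · exact Finset.sum_congr rfl fun i _ => by ring
        · ring
    _ ≤ ∑ j, p j * (l + 2 * max (|inner ℝ w (X j)| - l) 0 - inner ℝ w (X j) * s j) :=
        Finset.sum_le_sum fun j _ => mul_le_mul_of_nonneg_left (hpt _ _ _ (hs j) (ht j)) (hp j)
    _ = _ := by
        have h1 : ‖w‖ ^ 2 = ∑ j, p j * s j * inner ℝ w (X j) := by
          rw [← real_inner_self_eq_norm_sq]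
          nth_rw 2 [hw]
          rw [inner_sum]
          exact Finset.sum_congr rfl fun i _ => by rw [real_inner_smul_right]
        have h2 : ∀ Y, l + Y = ∑ i, l * p i + Y := fun Y => by rw [← Finset.mul_sum, hp1, mul_one]
        rw [h1, Finset.mul_sum, h2 (∑ i, _), ← Finset.sum_add_distrib, ← Finset.sum_sub_distrib]
        exact Finset.sum_congr rfl fun i _ => by ring

/-- The directions of the `X i` as unit vectors in Grothendieck's inequality: the matrix
`E X ⊗ X / ‖X‖` has Hilbert-Schmidt norm squared at least its trace squared over `n`. -/
theorem le_sum_barycentreForm_mul_inner (hp : ∀ i, 0 ≤ p i) (hp1 : ∑ i, p i = 1) (hl : 0 ≤ l)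
    (hn : 0 < n) :
    (∑ i, p i * ‖X i‖) ^ 2 / n - l ≤
      ∑ i, ∑ j, barycentreForm p X l i j * inner ℝ (‖X i‖⁻¹ • X i) (‖X j‖⁻¹ • X j) := by
  set a : ι → EuclideanSpace ℝ (Fin n) := fun i => ‖X i‖⁻¹ • X i with ha
  have haX : ∀ i, inner ℝ (X i) (a i) = ‖X i‖ := fun i => by
    rw [ha, real_inner_smul_right, real_inner_self_eq_norm_sq]
    rcases eq_or_ne ‖X i‖ 0 with h | h
    · simp [h]
    · field_simp
  have ha1 : ∀ i, inner ℝ (a i) (a i) ≤ (1 : ℝ) := fun i => by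
    rw [real_inner_self_eq_norm_sq, ha, norm_smul, norm_inv, norm_norm]
    rcases eq_or_ne ‖X i‖ 0 with h | h
    · simp [h]
    · field_simp
      exact le_rfl
  let M : Fin n → Fin n → ℝ := fun k m => ∑ i, p i * (X i k * a i m)
  have hHS : ∑ i, ∑ j, p i * p j * inner ℝ (X i) (X j) * inner ℝ (a i) (a j) =
      ∑ k, ∑ m, M k m ^ 2 := by
    have h1 : ∀ k m, M k m ^ 2 =
        ∑ i, ∑ j, p i * (X i k * a i m) * (p j * (X j k * a j m)) := fun k m => by
      rw [sq, Finset.sum_mul_sum]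
    simp only [h1]
    calc _ = ∑ i, ∑ j, ∑ k, ∑ m, p i * (X i k * a i m) * (p j * (X j k * a j m)) := by
          refine Finset.sum_congr rfl fun i _ => Finset.sum_congr rfl fun j _ => ?_
          simp only [PiLp.inner_apply, RCLike.inner_apply, conj_trivial]
          rw [mul_assoc, Finset.sum_mul_sum, Finset.mul_sum]
          refine Finset.sum_congr rfl fun k _ => ?_
          rw [Finset.mul_sum]
          exact Finset.sum_congr rfl fun m _ => by ring
      _ = ∑ i, ∑ k, ∑ j, ∑ m, p i * (X i k * a i m) * (p j * (X j k * a j m)) :=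
          Finset.sum_congr rfl fun i _ => Finset.sum_comm
      _ = ∑ k, ∑ i, ∑ j, ∑ m, p i * (X i k * a i m) * (p j * (X j k * a j m)) := Finset.sum_comm
      _ = ∑ k, ∑ i, ∑ m, ∑ j, p i * (X i k * a i m) * (p j * (X j k * a j m)) :=
          Finset.sum_congr rfl fun k _ => Finset.sum_congr rfl fun i _ => Finset.sum_comm
      _ = _ := Finset.sum_congr rfl fun k _ => Finset.sum_comm
  have htr : ∑ k, M k k = ∑ i, p i * ‖X i‖ := by
    simp only [M]
    rw [Finset.sum_comm]
    refine Finset.sum_congr rfl fun i _ => ?_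
    rw [← haX, PiLp.inner_apply, Finset.mul_sum]
    exact Finset.sum_congr rfl fun k _ => by simp [mul_comm]
  have hn' : (0 : ℝ) < n := Nat.cast_pos.2 hn
  -- The Hilbert-Schmidt norm dominates the diagonal, and Cauchy–Schwarz the trace.
  have h1 : (∑ i, p i * ‖X i‖) ^ 2 / n ≤ ∑ k, ∑ m, M k m ^ 2 := by
    rw [← htr, div_le_iff₀ hn', mul_comm]
    calc (∑ k, M k k) ^ 2 ≤ n * ∑ k, M k k ^ 2 := by
          simpa using sq_sum_le_card_mul_sum_sq (s := Finset.univ) (f := fun k => M k k)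
      _ ≤ _ := mul_le_mul_of_nonneg_left (Finset.sum_le_sum fun k _ =>
          Finset.single_le_sum (f := fun m => M k m ^ 2) (fun m _ => sq_nonneg _)
            (Finset.mem_univ k)) hn'.le
  have h2 : l * ∑ i, p i * inner ℝ (a i) (a i) ≤ l := by
    refine mul_le_of_le_one_right hl ?_
    rw [← hp1]
    exact Finset.sum_le_sum fun i _ => mul_le_of_le_one_right (hp i) (ha1 i)
  rw [sum_barycentreForm_mul, hHS]
  linarith

end Form

end

section

open ProbabilityTheory Real Filter Topology

/-- The form of `barycentreForm` for a finite model of the Gaussian vector in dimension `n`. The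
scalar values are controlled by the one-dimensional marginals, the vector values by `E ‖x‖`. -/
theorem IsGrothendieckBound.sq_le_of_approx {C : ℝ} (hC : IsGrothendieckBound C) {n : ℕ}
    (hn : 0 < n) {δ : ℝ} (hδ : 0 < δ)
    (hδM : δ ≤ ∫ x, ‖x‖ ∂(stdGaussian (EuclideanSpace ℝ (Fin n)))) :
    ((∫ x, ‖x‖ ∂(stdGaussian (EuclideanSpace ℝ (Fin n)))) - δ) ^ 2 / n - optNorm / 4 ≤
      C * ((1 - optNorm / 4) / 1.67 +
        2 * (((∫ x, ‖x‖ ∂(stdGaussian (EuclideanSpace ℝ (Fin n)))) + δ) * δ)) := by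
  classical
  let E := EuclideanSpace ℝ (Fin n)
  set γ := stdGaussian E
  set M := ∫ x, ‖x‖ ∂γ
  set l := optNorm / 4 with hl
  have hl0 : 0 ≤ l := by have := optNorm_pos; positivity
  obtain ⟨Q, hQint, hQ⟩ := exists_simpleFunc_integral_norm_sub_le (E := E) hδ
  have hid : Integrable (fun x : E => x) γ := IsGaussian.integrable_id
  -- The law of `Q`, as a probability vector on its finite range.
  let ι := {y // y ∈ Q.range}
  let q : E → ι := fun x => ⟨Q x, Q.mem_range_self x⟩
  have hq : Measurable q := Q.measurable.subtype_mk
  let ν := γ.map q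
  have hν : IsProbabilityMeasure ν := Measure.isProbabilityMeasure_map hq.aemeasurable
  let p : ι → ℝ := fun i => ν.real {i}
  have hsum : ∀ F : E → ℝ, ∑ i, p i * F i = ∫ x, F (Q x) ∂γ := by
    intro F
    have h := integral_fintype (μ := ν) (f := fun i : ι => F i) Integrable.of_finite
    rw [integral_map hq.aemeasurable (measurable_of_finite _).aestronglyMeasurable] at h
    simpa [p, q] using h.symm
  have hp : ∀ i, 0 ≤ p i := fun i => measureReal_nonneg
  have hp1 : ∑ i, p i = 1 := by simpa using hsum fun _ => 1
  have hQnorm : Integrable (fun x => ‖Q x‖) γ := by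
    refine (hQint.add hid.norm).mono' (Measurable.aestronglyMeasurable
      Q.measurable.norm) (ae_of_all _ fun x => ?_)
    rw [norm_norm]
    calc ‖Q x‖ = ‖(Q x - x) + x‖ := by rw [sub_add_cancel]
      _ ≤ _ := norm_add_le _ _
  have hup : ∑ i, p i * ‖(i : E)‖ ≤ M + δ := by
    rw [hsum fun y => ‖y‖]
    calc ∫ x, ‖Q x‖ ∂γ ≤ ∫ x, (‖x‖ + ‖Q x - x‖) ∂γ := by
          refine integral_mono hQnorm (hid.norm.add hQint) fun x => ?_
          calc ‖Q x‖ = ‖x + (Q x - x)‖ := by rw [add_sub_cancel]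
            _ ≤ _ := norm_add_le _ _
      _ = M + ∫ x, ‖Q x - x‖ ∂γ := integral_add hid.norm hQint
      _ ≤ _ := by linarith
  have hlow : M - δ ≤ ∑ i, p i * ‖(i : E)‖ := by
    rw [hsum fun y => ‖y‖]
    calc M - δ ≤ M - ∫ x, ‖Q x - x‖ ∂γ := by linarith
      _ = ∫ x, (‖x‖ - ‖Q x - x‖) ∂γ := (integral_sub hid.norm hQint).symm
      _ ≤ ∫ x, ‖Q x‖ ∂γ := by
          refine integral_mono (hid.norm.sub hQint) hQnorm fun x => ?_
          have := norm_sub_norm_le x (x - Q x)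
          rw [sub_sub_cancel, norm_sub_rev x] at this
          exact this
  have hB : 0 < (1 - l) / 1.67 + 2 * ((M + δ) * δ) := by
    have h1 : optNorm ≤ 0.774 := optNorm_le
    have h2 : 0 < 1 - l := by rw [hl]; norm_num at h1; linarith
    have h3 : 0 ≤ M := integral_nonneg fun x => norm_nonneg _
    positivity
  have hscalar : ∀ s t : ι → ℝ, (∀ i, |s i| ≤ 1) → (∀ j, |t j| ≤ 1) →
      ∑ i, ∑ j, barycentreForm p (fun i : ι => (i : E)) l i j * (s i * t j) ≤
        (1 - l) / 1.67 + 2 * ((M + δ) * δ) := by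
    intro s t hs ht
    refine (sum_barycentreForm_mul_le p _ l hp hp1 hl0 hs ht).trans ?_
    set w : E := ∑ k : ι, (p k * s k) • (k : E) with hw
    have hwle : ‖w‖ ≤ M + δ := by
      refine le_trans ?_ hup
      refine (norm_sum_le _ _).trans (Finset.sum_le_sum fun i _ => ?_)
      rw [norm_smul, norm_mul, norm_eq_abs, norm_eq_abs, abs_of_nonneg (hp i)]
      exact mul_le_mul_of_nonneg_right (mul_le_of_le_one_right (hp i) (hs i)) (norm_nonneg _)
    have hexc : ∑ i : ι, p i * max (|inner ℝ w (i : E)| - l) 0 ≤ meanExcess l ‖w‖ + ‖w‖ * δ := by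
      rw [hsum fun y => max (|inner ℝ w y| - l) 0, ← integral_excess_inner_stdGaussian (E := E)]
      have hcs : ∀ y : E, max (|inner ℝ w y| - l) 0 ≤ ‖w‖ * ‖y‖ := fun y =>
        max_le (by linarith [abs_real_inner_le_norm w y]) (by positivity)
      have hint1 : Integrable (fun x => max (|inner ℝ w (Q x)| - l) 0) γ := by
        refine (hQnorm.const_mul ‖w‖).mono' (Measurable.aestronglyMeasurable ?_)
          (ae_of_all _ fun x => ?_)
        · have : Measurable fun y : E => max (|inner ℝ w y| - l) 0 := by fun_prop
          exact this.comp Q.measurable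
        · rw [norm_eq_abs, abs_of_nonneg (le_max_right _ _)]
          exact hcs _
      have hint2 : Integrable (fun x => max (|inner ℝ w x| - l) 0) γ := by
        refine (hid.norm.const_mul ‖w‖).mono' (Measurable.aestronglyMeasurable (by fun_prop))
          (ae_of_all _ fun x => ?_)
        rw [norm_eq_abs, abs_of_nonneg (le_max_right _ _)]
        exact hcs _
      calc ∫ x, max (|inner ℝ w (Q x)| - l) 0 ∂γ
          ≤ ∫ x, (max (|inner ℝ w x| - l) 0 + ‖w‖ * ‖Q x - x‖) ∂γ := by
            refine integral_mono hint1 (hint2.add (hQint.const_mul _)) fun x => ?_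
            have h1 : |inner ℝ w (Q x)| ≤ |inner ℝ w x| + ‖w‖ * ‖Q x - x‖ := by
              have h2 : inner ℝ w (Q x) = inner ℝ w x + inner ℝ w (Q x - x) := by
                rw [← inner_add_right, add_sub_cancel]
              rw [h2]
              exact (abs_add_le _ _).trans (by gcongr; exact abs_real_inner_le_norm _ _)
            have h3 : 0 ≤ ‖w‖ * ‖Q x - x‖ := by positivity
            refine max_le ?_ ?_
            · linarith [le_max_left (|inner ℝ w x| - l) 0]
            · linarith [le_max_right (|inner ℝ w x| - l) 0]
        _ = ∫ x, max (|inner ℝ w x| - l) 0 ∂γ + ‖w‖ * ∫ x, ‖Q x - x‖ ∂γ := by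
            rw [integral_add hint2 (hQint.const_mul _), integral_const_mul]
        _ ≤ _ := by gcongr
    have hopt := meanExcess_bound (norm_nonneg w)
    rw [← hl] at hopt
    have h4 : l + 2 * meanExcess l ‖w‖ - ‖w‖ ^ 2 ≤ (1 - l) / 1.67 := by
      rw [le_div_iff₀ (by norm_num)]
      linarith
    have h5 : ‖w‖ * δ ≤ (M + δ) * δ := by gcongr
    linarith
  have hunit : ∀ i : ι, ‖‖(i : E)‖⁻¹ • (i : E)‖ ≤ 1 := fun i => by
    rw [norm_smul, norm_inv, norm_norm]
    exact inv_mul_le_one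
  have h1 := hC.sum_le hB hscalar hunit
  have h2 := le_sum_barycentreForm_mul_inner p (fun i : ι => (i : E)) l hp hp1 hl0 hn
  have h3 : (M - δ) ^ 2 / n ≤ (∑ i, p i * ‖(i : E)‖) ^ 2 / n := by
    have : 0 ≤ M - δ := by linarith
    gcongr
  linarith

/-- The lower bound of Davie and Reeds, to two decimals. -/
theorem IsGrothendieckBound.le {C : ℝ} (hC : IsGrothendieckBound C) : 1.67 ≤ C := by
  set l := optNorm / 4 with hl
  have hl1 : 0 < 1 - l := by
    have h1 : optNorm ≤ 0.774 := optNorm_le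
    rw [hl]; norm_num at h1; linarith
  set v := Var[fun t => t ^ 2; gaussianReal 0 1]
  have hlim : Tendsto (fun n : ℕ => 1 - v / 2 * (n : ℝ)⁻¹) atTop (𝓝 1) := by
    have := (tendsto_inv_atTop_nhds_zero_nat (𝕜 := ℝ)).const_mul (v / 2)
    simpa using this.const_sub 1
  -- The discretized dimension-`n` bound with accuracy `δ → 0`, then `n → ∞`.
  have hev : ∀ᶠ n : ℕ in atTop,
      (1 - v / 2 * (n : ℝ)⁻¹) ^ 2 - l ≤ C * ((1 - l) / 1.67) := by
    filter_upwards [eventually_gt_atTop 0, hlim.eventually (lt_mem_nhds zero_lt_one)] with n hn hpos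
    set M := ∫ x, ‖x‖ ∂(stdGaussian (EuclideanSpace ℝ (Fin n))) with hM
    have hn' : (0 : ℝ) < n := Nat.cast_pos.2 hn
    have h1 : √n * (1 - v / 2 * (n : ℝ)⁻¹) ≤ M := by
      rw [show v / 2 * (n : ℝ)⁻¹ = v / (2 * n) by field_simp]
      exact sqrt_mul_le_integral_norm_stdGaussian hn
    have hM0 : 0 < M := lt_of_lt_of_le (mul_pos (sqrt_pos.2 hn') hpos) h1
    have h2 : M ^ 2 / n - l ≤ C * ((1 - l) / 1.67) := by
      have hL : Tendsto (fun δ : ℝ => (M - δ) ^ 2 / n - l) (𝓝[>] 0) (𝓝 (M ^ 2 / n - l)) := by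
        have : Continuous fun δ : ℝ => (M - δ) ^ 2 / n - l := by fun_prop
        simpa using (this.tendsto 0).mono_left nhdsWithin_le_nhds
      have hR : Tendsto (fun δ : ℝ => C * ((1 - l) / 1.67 + 2 * ((M + δ) * δ))) (𝓝[>] 0)
          (𝓝 (C * ((1 - l) / 1.67))) := by
        have : Continuous fun δ : ℝ => C * ((1 - l) / 1.67 + 2 * ((M + δ) * δ)) := by fun_prop
        simpa using (this.tendsto 0).mono_left nhdsWithin_le_nhds
      refine le_of_tendsto_of_tendsto hL hR ?_
      filter_upwards [Ioc_mem_nhdsGT hM0] with δ hδ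
      exact hC.sq_le_of_approx hn hδ.1 hδ.2
    refine le_trans ?_ h2
    have h3 : (√n * (1 - v / 2 * (n : ℝ)⁻¹)) ^ 2 ≤ M ^ 2 := by
      gcongr
    rw [mul_pow, sq_sqrt hn'.le] at h3
    have h4 : (1 - v / 2 * (n : ℝ)⁻¹) ^ 2 ≤ M ^ 2 / n := by
      rw [le_div_iff₀ hn']
      linarith
    linarith
  have hfin := le_of_tendsto ((hlim.pow 2).sub_const l) hev
  rw [one_pow, ← mul_div_assoc, le_div_iff₀ (by norm_num)] at hfin
  nlinarith

end

section

/-! ### Cluster ratios -/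

section Ratio

variable {S : Type u} {T : Type v} {Γ Δ : Type} [MeasurableSpace Γ] [MeasurableSpace Δ]

theorem clusterRatio_le {Z W : S → T → ℝ} {r : ℝ} (hr : 0 ≤ r) (hW : W ∈ convIncidence Γ S T)
    (hZ : ∀ x y, Z x y = r * W x y) : clusterRatio Γ Z ≤ ENNReal.ofReal r := by
  have hZ' : Z = r • W := by funext x y; exact hZ x y
  exact iInf₂_le (r.toNNReal) ⟨W, hW, by rw [Real.coe_toNNReal r hr]; exact hZ'.symm⟩

theorem exists_of_clusterRatio_lt {Z : S → T → ℝ} {c : ℝ≥0∞} (h : clusterRatio Γ Z < c) :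
    ∃ r : ℝ, 0 ≤ r ∧ ENNReal.ofReal r < c ∧ ∃ W ∈ convIncidence Γ S T,
      ∀ x y, Z x y = r * W x y := by
  simp only [clusterRatio, iInf_lt_iff] at h
  obtain ⟨r, ⟨W, hW, hZ⟩, hr⟩ := h
  exact ⟨r, r.2, by simpa using hr, W, hW, fun x y => by rw [← hZ]; rfl⟩

theorem le_clusterRatio {Z : S → T → ℝ} {c : ℝ≥0∞}
    (h : ∀ r : ℝ, 0 ≤ r → ∀ W ∈ convIncidence Γ S T, (∀ x y, Z x y = r * W x y) →
      c ≤ ENNReal.ofReal r) : c ≤ clusterRatio Γ Z := by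
  by_contra hlt
  obtain ⟨r, hr, hrc, W, hW, hZ⟩ := exists_of_clusterRatio_lt (not_le.1 hlt)
  exact absurd hrc (not_lt.2 (h r hr W hW hZ))

theorem centralizedClusterRatio_le {Z W : S → T → ℝ} {r : ℝ} (θ : ℝ) (hr : 0 ≤ r)
    (hW : W ∈ convIncidence Γ S T) (hZ : ∀ x y, Z x y - θ = r * W x y) :
    centralizedClusterRatio Γ Z ≤ ENNReal.ofReal r :=
  (iInf_le _ θ).trans (clusterRatio_le hr hW hZ)

theorem le_centralizedClusterRatio {Z : S → T → ℝ} {c : ℝ≥0∞}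
    (h : ∀ θ r : ℝ, 0 ≤ r → ∀ W ∈ convIncidence Γ S T, (∀ x y, Z x y - θ = r * W x y) →
      c ≤ ENNReal.ofReal r) : c ≤ centralizedClusterRatio Γ Z :=
  le_iInf fun θ => le_clusterRatio (h θ)

theorem clusterRatio_mono (h : convIncidence Γ S T ⊆ convIncidence Δ S T) (Z : S → T → ℝ) :
    clusterRatio Δ Z ≤ clusterRatio Γ Z :=
  le_clusterRatio fun _ hr _ hW hZ => clusterRatio_le hr (h hW) hZ

theorem centralizedClusterRatio_mono (h : convIncidence Γ S T ⊆ convIncidence Δ S T)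
    (Z : S → T → ℝ) : centralizedClusterRatio Δ Z ≤ centralizedClusterRatio Γ Z :=
  iInf_mono fun _ => clusterRatio_mono h _

theorem convIncidence_fin_subset_fin {k : ℕ} (hk : 2 ≤ k) (S : Type u) (T : Type v) :
    convIncidence (Fin 2) S T ⊆ convIncidence (Fin k) S T :=
  convIncidence_subset_of_injective _ (Fin.castLE_injective hk)

theorem convIncidence_fin_subset_nat (k : ℕ) (S : Type u) (T : Type v) :
    convIncidence (Fin k) S T ⊆ convIncidence ℕ S T :=
  convIncidence_subset_of_injective _ Fin.val_injective

theorem maxNorm_le_clusterRatio_two (Z : S → T → ℝ) : maxNorm Z ≤ clusterRatio (Fin 2) Z :=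
  le_clusterRatio fun r hr W hW hZ => by
    rw [show Z = r • W by funext x y; exact hZ x y]
    exact maxNorm_smul_le_of_mem_convIncidence_two hW hr

theorem centralizedMaxNorm_le_two (Z : S → T → ℝ) :
    centralizedMaxNorm Z ≤ centralizedClusterRatio (Fin 2) Z :=
  iInf_mono fun _ => maxNorm_le_clusterRatio_two _

theorem maxNorm_le_three_mul_clusterRatio [DiscreteMeasurableSpace Γ] [Countable Γ]
    (Z : S → T → ℝ) : maxNorm Z ≤ 3 * clusterRatio Γ Z := by
  rw [← ENNReal.div_le_iff' (by norm_num) (by norm_num)]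
  refine le_clusterRatio fun r hr W hW hZ => ?_
  rw [ENNReal.div_le_iff' (by norm_num) (by norm_num), show Z = r • W by funext x y; exact hZ x y]
  refine (maxNorm_smul_le_of_mem_convIncidence hW hr).trans ?_
  rw [mul_comm, ENNReal.ofReal_mul (by norm_num)]
  simp

/-- Hashing the letters to signs at most doubles the centralized ratio; the shift it causes is
absorbed by `θ`. -/
theorem centralizedClusterRatio_two_le [DiscreteMeasurableSpace Γ] [Countable Γ]
    (Z : S → T → ℝ) : centralizedClusterRatio (Fin 2) Z ≤ 2 * centralizedClusterRatio Γ Z := by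
  rw [← ENNReal.div_le_iff' (by norm_num) (by norm_num)]
  refine le_centralizedClusterRatio fun θ r hr W hW hZ => ?_
  rw [ENNReal.div_le_iff' (by norm_num) (by norm_num)]
  refine (centralizedClusterRatio_le (θ - r) (r := 2 * r) (by positivity)
    (half_add_one_mem_convIncidence_two hW) fun x y => ?_).trans ?_
  · linarith [hZ x y]
  · rw [ENNReal.ofReal_mul (by norm_num)]
    simp

theorem leastALSH_eq [Nonempty Γ] [DiscreteMeasurableSpace Γ] [Countable Γ] (Z : S → T → ℝ) :
    leastALSH Γ Z = centralizedClusterRatio Γ Z := by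
  refine le_antisymm ?_ ?_
  · refine le_centralizedClusterRatio fun θ r hr W hW hZ => ?_
    rcases hr.eq_or_lt with rfl | hr
    · -- A constant similarity has an `α`-ALSH for every `α > 0`: hash everything to one letter.
      rw [ENNReal.ofReal_zero]
      refine le_of_forall_gt_imp_ge_of_dense fun ε hε => ?_
      obtain ⟨α, -, h1, h2⟩ := ENNReal.lt_iff_exists_real_btwn.1 hε
      obtain ⟨P, hP, hP1⟩ := one_mem_convIncidence (Γ := Γ) (S := S) (T := T)
      refine (iInf₂_le α ⟨P, by simpa using h1, hP, α - θ, fun x y => ?_⟩).trans h2.le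
      rw [← hP1]
      linarith [hZ x y]
    · obtain ⟨P, hP, rfl⟩ := hW
      exact iInf₂_le r ⟨P, hr, hP, -θ, fun x y => by linarith [hZ x y]⟩
  · refine le_iInf₂ fun α hα => ?_
    obtain ⟨P, hα, hP, θ, h⟩ := hα
    exact centralizedClusterRatio_le (-θ) hα.le ⟨P, hP, rfl⟩ fun x y => by linarith [h x y]

/-- For the binary alphabet the infimum in the cluster ratio is attained. -/
theorem mem_convIncidence_two_of_clusterRatio_le_one {Z : S → T → ℝ}
    (hZ : clusterRatio (Fin 2) Z ≤ 1) : Z ∈ convIncidence (Fin 2) S T := by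
  have hlt : ∀ c : ℝ, 0 < c → c < 1 → c • Z ∈ convIncidence (Fin 2) S T := by
    intro c hc0 hc1
    obtain ⟨r, hr, hrc, W, hW, hZW⟩ := exists_of_clusterRatio_lt
      (lt_of_le_of_lt hZ (show (1 : ℝ≥0∞) < ENNReal.ofReal c⁻¹ by
        rw [← ENNReal.ofReal_one]
        exact (ENNReal.ofReal_lt_ofReal_iff (by positivity)).2 ((one_lt_inv₀ hc0).2 hc1)))
    have hrc' : r < c⁻¹ := (ENNReal.ofReal_lt_ofReal_iff (by positivity)).1 hrc
    have h1 : |c * r| ≤ 1 := by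
      rw [abs_of_nonneg (by positivity)]
      calc c * r ≤ c * c⁻¹ := by gcongr
        _ = 1 := mul_inv_cancel₀ hc0.ne'
    convert smul_mem_convIncidence_two hW h1 using 1
    funext x y
    simp only [Pi.smul_apply, smul_eq_mul, hZW]
    ring
  refine mem_convIncidence_two_of_finset fun F G => ?_
  -- The closed hull over finite domains contains the limit `c → 1` of `c • Z`.
  have hcont : Continuous fun c : ℝ => fun (x : F) (y : G) => c * Z x y := by fun_prop
  have hlim := (hcont.tendsto 1).mono_left (nhdsWithin_le_nhds (s := Set.Iio 1))
  simp only [one_mul] at hlim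
  refine isClosed_convIncidence.mem_of_tendsto hlim ?_
  filter_upwards [Ioo_mem_nhdsLT (zero_lt_one (α := ℝ))] with c hc
  exact comp_mem_convIncidence (hlt c hc.1 hc.2) (fun x : F => (x : S)) fun y : G => (y : T)

end Ratio

/-! ### The optimal constant -/

/-- `K` bounds the binary cluster ratio in terms of the max-norm. -/
def IsRatioBound (K : ℝ) : Prop :=
  0 ≤ K ∧ ∀ (S : Type u) (T : Type v) (Z : S → T → ℝ),
    clusterRatio (Fin 2) Z ≤ ENNReal.ofReal K * maxNorm Z

/-- The least constant `K` that bounds the binary cluster ratio by `K` times the max-norm, over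
all domains. -/
def ratioConstant : ℝ := sInf {K | IsRatioBound.{u, v} K}

theorem le_mul_maxNorm {S : Type u} {T : Type v} {Z : S → T → ℝ} {x : ℝ≥0∞} {K : ℝ} (hK : 0 < K)
    (h : ∀ m : ℝ, maxNorm Z < ENNReal.ofReal m → x ≤ ENNReal.ofReal (K * m)) :
    x ≤ ENNReal.ofReal K * maxNorm Z := by
  have hK' : ENNReal.ofReal K ≠ 0 := by simpa using hK
  rw [← ENNReal.div_le_iff' hK' ENNReal.ofReal_ne_top]
  by_contra hlt
  obtain ⟨m, -, h1, h2⟩ := ENNReal.lt_iff_exists_real_btwn.1 (not_le.1 hlt)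
  have h3 := h m h1
  rw [ENNReal.ofReal_mul hK.le, ← ENNReal.div_le_iff' hK' ENNReal.ofReal_ne_top] at h3
  exact absurd h2 (not_lt.2 h3)

theorem isRatioBound_krivineConstant : IsRatioBound.{u, v} krivineConstant := by
  have hK := krivineConstant_pos
  refine ⟨hK.le, fun S T Z => le_mul_maxNorm hK fun m hm => ?_⟩
  have hm0 : 0 < m := ENNReal.ofReal_pos.1 (lt_of_le_of_lt bot_le hm)
  obtain ⟨H, i1, i2, i3, U, V, hZ, hU, hV⟩ := exists_inner_of_maxNorm_lt hm
  have hs : (√m)⁻¹ ^ 2 = m⁻¹ := by rw [inv_pow, Real.sq_sqrt hm0.le]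
  have hnorm : ∀ z : H, ‖z‖ ^ 2 ≤ m → ‖(√m)⁻¹ • z‖ ^ 2 ≤ 1 := by
    intro z hz
    rw [norm_smul, mul_pow, Real.norm_eq_abs, sq_abs, hs, inv_mul_le_iff₀ hm0]
    linarith
  refine clusterRatio_le (by positivity) (inner_div_krivineConstant_mem_convIncidence
    (U := fun x => (√m)⁻¹ • U x) (V := fun y => (√m)⁻¹ • V y) (fun x => hnorm _ (hU x))
    fun y => hnorm _ (hV y)) fun x y => ?_
  rw [real_inner_smul_left, real_inner_smul_right, ← mul_assoc, ← sq, hs, hZ]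
  field_simp

theorem abs_sum_mul_le_of_mem_convIncidence_two {S : Type u} {T : Type v} [Fintype S] [Fintype T]
    {A : S → T → ℝ} (hA : ∀ (s : S → ℝ) (t : T → ℝ), (∀ i, |s i| ≤ 1) → (∀ j, |t j| ≤ 1) →
      |∑ i, ∑ j, A i j * (s i * t j)| ≤ 1) {W : S → T → ℝ}
    (hW : W ∈ convIncidence (Fin 2) S T) : |∑ i, ∑ j, A i j * W i j| ≤ 1 := by
  obtain ⟨P, hP, rfl⟩ := hW
  have h1 : ∑ i, ∑ j, A i j * expectedIncidence P i j =
      ∫ h, ∑ i, ∑ j, A i j * kappa h.1 h.2 i j ∂P := by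
    rw [integral_finsetSum _ fun i _ => integrable_finsetSum _ fun j _ =>
      (integrable_kappa P i j).const_mul _]
    refine Finset.sum_congr rfl fun i _ => ?_
    rw [integral_finsetSum _ fun j _ => (integrable_kappa P i j).const_mul _]
    exact Finset.sum_congr rfl fun j _ => by rw [integral_const_mul]; rfl
  rw [h1]
  have := norm_integral_le_of_norm_le_const (μ := P) (C := 1)
    (f := fun h : (S → Fin 2) × (T → Fin 2) => ∑ i, ∑ j, A i j * kappa h.1 h.2 i j)
    (ae_of_all _ fun h => by
      simp only [kappa_two]
      exact hA _ _ (fun i => (abs_sgn _).le) fun j => (abs_sgn _).le)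
  simpa using this

/-- A finite configuration of unit vectors has max-norm at most one, so an upper bound for the
cluster ratio puts it into the convex hull, where matrices act as they do on signs. -/
theorem IsRatioBound.isGrothendieckBound {K : ℝ} (hK : IsRatioBound.{u, v} K) :
    IsGrothendieckBound K := by
  intro m n A hA H _ _ _ a b ha hb
  let S := ULift.{u} (Fin m)
  let T := ULift.{v} (Fin n)
  let Z : S → T → ℝ := fun i j => inner ℝ (a i.down) (b j.down)
  have hsum : ∀ F : Fin m → Fin n → ℝ,
      ∑ i : S, ∑ j : T, F i.down j.down = ∑ i, ∑ j, F i j := fun F => by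
    rw [← Equiv.ulift.{u}.symm.sum_comp]
    refine Finset.sum_congr rfl fun i _ => ?_
    rw [← Equiv.ulift.{v}.symm.sum_comp]
    rfl
  have hmax : maxNorm Z ≤ 1 := by
    -- The universe of `H` may differ from `max u v`, hence a realization in coordinates.
    obtain ⟨w, hw⟩ := exists_gram_eq_of_posSemidef (Matrix.posSemidef_gram ℝ
      (Sum.elim (fun i : S => a i.down) fun j : T => b j.down))
    have hw1 : ∀ i, ‖w i‖ ^ 2 ≤ 1 := by
      intro i
      rw [← real_inner_self_eq_norm_sq, hw, Matrix.gram_apply, real_inner_self_eq_norm_sq]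
      refine pow_le_one₀ (norm_nonneg _) ?_
      rcases i with i | j
      exacts [ha _, hb _]
    have := maxNorm_le_of_inner (Z := Z) (U := fun i => w (Sum.inl i)) (V := fun j => w (Sum.inr j))
      (fun i j => by rw [hw]; rfl) (fun i => hw1 _) fun j => hw1 _
    simpa using this
  have hratio : clusterRatio (Fin 2) Z ≤ ENNReal.ofReal K :=
    (hK.2 S T Z).trans (mul_le_of_le_one_right' hmax)
  refine le_of_forall_gt_imp_ge_of_dense fun c hc => ?_
  have hc0 : 0 < c := lt_of_le_of_lt hK.1 hc
  obtain ⟨r, hr, hrc, W, hW, hZ⟩ := exists_of_clusterRatio_lt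
    (lt_of_le_of_lt hratio ((ENNReal.ofReal_lt_ofReal_iff hc0).2 hc))
  have hW1 := abs_sum_mul_le_of_mem_convIncidence_two (A := fun (i : S) (j : T) => A i.down j.down)
    (fun s t hs ht => by
      have := hA (fun i => s ⟨i⟩) (fun j => t ⟨j⟩) (fun i => hs _) fun j => ht _
      rwa [← hsum fun i j => A i j * (s ⟨i⟩ * t ⟨j⟩)] at this) hW
  have h1 : ∑ i, ∑ j, A i j * inner ℝ (a i) (b j) =
      r * ∑ i : S, ∑ j : T, A i.down j.down * W i j := by
    rw [← hsum fun i j => A i j * inner ℝ (a i) (b j), Finset.mul_sum]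
    refine Finset.sum_congr rfl fun i _ => ?_
    rw [Finset.mul_sum]
    refine Finset.sum_congr rfl fun j _ => ?_
    have := hZ i j
    simp only [Z] at this
    rw [this]
    ring
  rw [h1, abs_mul, abs_of_nonneg hr]
  calc r * _ ≤ r * 1 := by gcongr
    _ = r := mul_one r
    _ ≤ c := ((ENNReal.ofReal_lt_ofReal_iff hc0).1 hrc).le

theorem grothendieckConstant_le {C : ℝ} (hC : IsGrothendieckBound C) : grothendieckConstant ≤ C :=
  csInf_le ⟨1.67, fun _ h => IsGrothendieckBound.le h⟩ hC

theorem le_grothendieckConstant : 1.67 ≤ grothendieckConstant :=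
  le_csInf ⟨krivineConstant, isRatioBound_krivineConstant.{0, 0}.isGrothendieckBound⟩
    fun _ h => IsGrothendieckBound.le h

theorem grothendieckConstant_le_ratioConstant : grothendieckConstant ≤ ratioConstant.{u, v} :=
  le_csInf ⟨krivineConstant, isRatioBound_krivineConstant⟩
    fun _ h => grothendieckConstant_le h.isGrothendieckBound

theorem bddBelow_isRatioBound : BddBelow {K | IsRatioBound.{u, v} K} := ⟨0, fun _ h => h.1⟩

theorem ratioConstant_le_krivineConstant : ratioConstant.{u, v} ≤ krivineConstant :=
  csInf_le bddBelow_isRatioBound isRatioBound_krivineConstant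

theorem ratioConstant_pos : 0 < ratioConstant.{u, v} :=
  lt_of_lt_of_le (by norm_num)
    (le_grothendieckConstant.trans grothendieckConstant_le_ratioConstant.{u, v})

open Filter Topology in
theorem isRatioBound_ratioConstant : IsRatioBound.{u, v} ratioConstant.{u, v} := by
  refine ⟨ratioConstant_pos.le, fun S T Z => ?_⟩
  have hne : ENNReal.ofReal ratioConstant.{u, v} ≠ 0 := by simpa using ratioConstant_pos
  have hlim : Tendsto (fun K => ENNReal.ofReal K * maxNorm Z) (𝓝[>] ratioConstant.{u, v})
      (𝓝 (ENNReal.ofReal ratioConstant.{u, v} * maxNorm Z)) :=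
    ENNReal.Tendsto.mul_const ((ENNReal.continuous_ofReal.tendsto _).mono_left
      nhdsWithin_le_nhds) (Or.inl hne)
  refine ge_of_tendsto hlim ?_
  filter_upwards [self_mem_nhdsWithin] with K hK
  obtain ⟨K', hK', hlt⟩ := exists_lt_of_csInf_lt
    ⟨krivineConstant, isRatioBound_krivineConstant.{u, v}⟩ hK
  exact (hK'.2 S T Z).trans (by gcongr)

theorem exists_lt_clusterRatio {c : ℝ} (hc : c < ratioConstant.{u, v}) :
    ∃ (S : Type u) (T : Type v) (Z : S → T → ℝ),
      ENNReal.ofReal c * maxNorm Z < clusterRatio (Fin 2) Z := by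
  by_contra! h
  have hb : IsRatioBound.{u, v} (max c 0) := ⟨le_max_right _ _, fun S T Z => by
    rw [ENNReal.ofReal_max, ENNReal.ofReal_zero, max_eq_left zero_le]
    exact h S T Z⟩
  exact absurd (csInf_le bddBelow_isRatioBound hb) (not_le.2 (max_lt hc ratioConstant_pos))

/-- Stacking `Z` on top of `-Z` makes centralization useless: averaging the two blocks, the second
one negated, removes the shift. -/
theorem exists_lt_centralizedClusterRatio {c : ℝ} (hc : c < ratioConstant.{u, v}) :
    ∃ (S : Type u) (T : Type v) (Z : S → T → ℝ),
      ENNReal.ofReal c * centralizedMaxNorm Z < centralizedClusterRatio (Fin 2) Z := by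
  obtain ⟨S, T, Z, h⟩ := exists_lt_clusterRatio hc
  let Z' : S ⊕ S → T → ℝ := fun x y => Sum.elim (fun x => Z x y) (fun x => -Z x y) x
  have hmax : centralizedMaxNorm Z' ≤ maxNorm Z := by
    have h0 : maxNorm Z' ≤ maxNorm Z := by
      have := le_mul_maxNorm (Z := Z) (x := maxNorm Z') one_pos fun m hm => by
        obtain ⟨H, i1, i2, i3, U, V, hZ, hU, hV⟩ := exists_inner_of_maxNorm_lt hm
        rw [one_mul]
        refine maxNorm_le_of_inner (U := Sum.elim U fun x => -U x) (V := V) ?_ ?_ hV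
        · rintro (x | x) y <;> simp [Z', hZ]
        · rintro (x | x) <;> simpa using hU x
      simpa using this
    refine (iInf_le _ 0).trans ?_
    simpa using h0
  have hratio : clusterRatio (Fin 2) Z ≤ centralizedClusterRatio (Fin 2) Z' := by
    refine le_centralizedClusterRatio fun θ r hr W hW hZ => ?_
    have h1 := comp_mem_convIncidence hW (Sum.inl : S → S ⊕ S) (id : T → T)
    have h2 := comp_mem_convIncidence hW (Sum.inr : S → S ⊕ S) (id : T → T)
    refine clusterRatio_le hr (convex_convIncidence h1 (neg_mem_convIncidence_two h2)
      (a := 1 / 2) (b := 1 / 2) (by norm_num) (by norm_num) (by norm_num)) fun x y => ?_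
    have e1 := hZ (Sum.inl x) y
    have e2 := hZ (Sum.inr x) y
    simp only [Z', Sum.elim_inl, Sum.elim_inr] at e1 e2
    simp only [Pi.add_apply, Pi.smul_apply, Pi.neg_apply, smul_eq_mul, id]
    linarith
  exact ⟨S ⊕ S, T, Z', lt_of_le_of_lt (by gcongr) (h.trans_le hratio)⟩

end

section

/-! ### The sign matrix -/

/-- The `2 × 2` matrix with `1` on the diagonal and `-1` elsewhere, as a similarity on lifted
two-point sets. -/
def signSim (x : ULift.{u} (Fin 2)) (y : ULift.{v} (Fin 2)) : ℝ := sgn x.down * sgn y.down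

theorem signSim_mem_convIncidence_two :
    signSim.{u, v} ∈ convIncidence (Fin 2) (ULift.{u} (Fin 2)) (ULift.{v} (Fin 2)) := by
  have h : signSim.{u, v} = kappa (fun x => x.down) (fun y => y.down) := by
    funext x y
    rw [kappa_two, signSim]
  rw [h]
  exact kappa_mem_convIncidence _ _

theorem clusterRatio_signSim {Γ : Type} [MeasurableSpace Γ]
    (h : ∀ (S : Type u) (T : Type v), convIncidence (Fin 2) S T ⊆ convIncidence Γ S T) :
    clusterRatio Γ signSim.{u, v} = 1 ∧ centralizedClusterRatio Γ signSim.{u, v} = 1 := by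
  have h1 : 1 ≤ centralizedClusterRatio Γ signSim.{u, v} := by
    refine le_centralizedClusterRatio fun θ r hr W hW hZ => ?_
    rw [← ENNReal.ofReal_one]
    refine ENNReal.ofReal_le_ofReal ?_
    have e0 := hZ ⟨0⟩ ⟨0⟩
    have e1 := hZ ⟨0⟩ ⟨1⟩
    have b0 := abs_le.1 (abs_le_one_of_mem_convIncidence hW ⟨0⟩ ⟨0⟩)
    have b1 := abs_le.1 (abs_le_one_of_mem_convIncidence hW ⟨0⟩ ⟨1⟩)
    norm_num [signSim, sgn] at e0 e1
    nlinarith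
  have h2 : clusterRatio Γ signSim.{u, v} ≤ 1 := by
    rw [← ENNReal.ofReal_one]
    exact clusterRatio_le zero_le_one (h _ _ signSim_mem_convIncidence_two) fun x y =>
      (one_mul _).symm
  have h3 : centralizedClusterRatio Γ signSim.{u, v} ≤ clusterRatio Γ signSim.{u, v} := by
    simpa [centralizedClusterRatio] using
      iInf_le (fun θ : ℝ => clusterRatio Γ fun x y => signSim.{u, v} x y - θ) 0
  exact ⟨h2.antisymm (h1.trans h3), (h3.trans h2).antisymm h1⟩

theorem centralizedMaxNorm_signSim : centralizedMaxNorm signSim.{u, v} = 1 := by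
  refine ((centralizedMaxNorm_le_two _).trans
    (clusterRatio_signSim fun _ _ => subset_rfl).2.le).antisymm (le_iInf fun θ => ?_)
  -- A shift moves one of the two entries `1` and `-1` away from zero.
  have e0 := ofReal_abs_le_maxNorm (fun x y => signSim.{u, v} x y - θ) ⟨0⟩ ⟨0⟩
  have e1 := ofReal_abs_le_maxNorm (fun x y => signSim.{u, v} x y - θ) ⟨0⟩ ⟨1⟩
  have s0 : signSim.{u, v} ⟨0⟩ ⟨0⟩ = 1 := by norm_num [signSim, sgn]
  have s1 : signSim.{u, v} ⟨0⟩ ⟨1⟩ = -1 := by norm_num [signSim, sgn]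
  simp only [s0, s1] at e0 e1
  rw [← ENNReal.ofReal_one]
  rcases le_total θ 0 with hθ | hθ
  · have : 1 ≤ |1 - θ| := (by linarith : 1 ≤ 1 - θ).trans (le_abs_self _)
    exact (ENNReal.ofReal_le_ofReal this).trans e0
  · have : 1 ≤ |-1 - θ| := (by linarith : 1 ≤ -(-1 - θ)).trans (neg_le_abs _)
    exact (ENNReal.ofReal_le_ofReal this).trans e1

/-! ### The identity matrix -/

/-- The infinite matrix with `1` on the diagonal and `-1` elsewhere, as a similarity on lifted
copies of the natural numbers. -/
def identitySim (x : ULift.{u} ℕ) (y : ULift.{v} ℕ) : ℝ := if x.down = y.down then 1 else -1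

theorem identitySim_mem_convIncidence :
    identitySim.{u, v} ∈ convIncidence ℕ (ULift.{u} ℕ) (ULift.{v} ℕ) := by
  have h : identitySim.{u, v} = kappa (fun x => x.down) (fun y => y.down) := by
    funext x y
    simp [kappa, identitySim]
  rw [h]
  exact kappa_mem_convIncidence _ _

/-- Testing a factorization of a shifted identity matrix against its leading `n × n` block with
weights `1 - t / n` on the diagonal and `-t / n` elsewhere. For `0 ≤ t ≤ 2` these weights form
a contraction, so that the left-hand side is at most the trace norm bound on the right. -/
theorem identity_test {H : Type w} [NormedAddCommGroup H] [InnerProductSpace ℝ H] {U V : ℕ → H}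
    {c θ m t : ℝ} (hc : 0 ≤ c)
    (hUV : ∀ i j, (if i = j then 1 else -1) - θ = c * inner ℝ (U i) (V j))
    (hU : ∀ i, ‖U i‖ ^ 2 ≤ m) (hV : ∀ j, ‖V j‖ ^ 2 ≤ m) (ht0 : 0 ≤ t) (ht2 : t ≤ 2)
    {n : ℕ} (hn : 0 < n) :
    n * (1 - θ) - t / n * (2 * n - n ^ 2 - n ^ 2 * θ) ≤ c * (n * m) := by
  have hn' : (0 : ℝ) < n := by exact_mod_cast hn
  set s := ∑ i ∈ Finset.range n, U i with hs
  have hsum : ∀ j ∈ Finset.range n, c * inner ℝ s (V j) = 2 - n - n * θ := by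
    intro j hj
    rw [hs, sum_inner, Finset.mul_sum]
    simp_rw [← hUV]
    rw [Finset.sum_sub_distrib, Finset.sum_congr rfl
      (g := fun i => (if i = j then (2 : ℝ) else 0) - 1)
      (fun i _ => by split_ifs <;> norm_num)]
    simp [Finset.sum_sub_distrib, Finset.mem_range.1 hj]
  -- The test matrix is the reflection or contraction `u i ↦ u i - (t / n) s` along the mean.
  have hnorm : ∑ i ∈ Finset.range n, ‖U i - (t / n) • s‖ ^ 2 ≤ n * m := by
    have h1 : ∀ i, ‖U i - (t / n) • s‖ ^ 2 =
        ‖U i‖ ^ 2 - 2 * (t / n) * inner ℝ (U i) s + (t / n) ^ 2 * ‖s‖ ^ 2 := fun i => by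
      rw [norm_sub_sq_real, inner_smul_right, norm_smul, mul_pow, Real.norm_eq_abs, sq_abs]
      ring
    simp_rw [h1]
    rw [Finset.sum_add_distrib, Finset.sum_sub_distrib, ← Finset.mul_sum, ← sum_inner, ← hs,
      real_inner_self_eq_norm_sq, Finset.sum_const, Finset.card_range, nsmul_eq_mul]
    have h2 : ∑ i ∈ Finset.range n, ‖U i‖ ^ 2 ≤ n * m := by
      simpa using Finset.sum_le_card_nsmul (Finset.range n) _ m fun i _ => hU i
    have h3 : 0 ≤ t * (2 - t) / n * ‖s‖ ^ 2 :=
      mul_nonneg (div_nonneg (mul_nonneg ht0 (by linarith)) hn'.le) (sq_nonneg _)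
    have h4 : (n : ℝ) * ((t / n) ^ 2 * ‖s‖ ^ 2) = t * t / n * ‖s‖ ^ 2 := by
      field_simp
    have h5 : t * (2 - t) / n * ‖s‖ ^ 2 = 2 * (t / n) * ‖s‖ ^ 2 - t * t / n * ‖s‖ ^ 2 := by ring
    linarith
  have hinner : ∑ i ∈ Finset.range n, inner ℝ (U i - (t / n) • s) (V i) ≤ n * m := by
    have h1 : ∀ i ∈ Finset.range n, inner ℝ (U i - (t / n) • s) (V i) ≤
        (‖U i - (t / n) • s‖ ^ 2 + m) / 2 := fun i _ => by
      have := real_inner_le_norm (U i - (t / n) • s) (V i)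
      nlinarith [sq_nonneg (‖U i - (t / n) • s‖ - ‖V i‖), hV i]
    refine (Finset.sum_le_sum h1).trans ?_
    rw [← Finset.sum_div, Finset.sum_add_distrib, Finset.sum_const, Finset.card_range,
      nsmul_eq_mul]
    linarith
  refine le_trans (le_of_eq ?_) (mul_le_mul_of_nonneg_left hinner hc)
  rw [Finset.mul_sum, Finset.sum_congr rfl (g := fun _ => 1 - θ - t / n * (2 - n - n * θ))
    (fun i hi => by
      rw [inner_sub_left, real_inner_smul_left, mul_sub, ← hUV, if_pos rfl, ← hsum i hi]
      ring), Finset.sum_const, Finset.card_range, nsmul_eq_mul]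
  ring

/-- A real bound that holds up to an error `O(1 / n)` holds. -/
theorem le_of_forall_nat_mul_sub_le {a b d : ℝ} (h : ∀ n : ℕ, 0 < n → n * a - d ≤ n * b) :
    a ≤ b := by
  by_contra! hlt
  obtain ⟨n, hn⟩ := exists_nat_gt (max 0 (d / (a - b)))
  have h0 : (0 : ℝ) < n := (le_max_left _ _).trans_lt hn
  have h1 : d / (a - b) < n := (le_max_right _ _).trans_lt hn
  rw [div_lt_iff₀ (by linarith)] at h1
  have := h n (by exact_mod_cast h0)
  linarith

theorem two_le_centralizedClusterRatio_identitySim :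
    2 ≤ centralizedClusterRatio (Fin 2) identitySim.{u, v} := by
  refine le_centralizedClusterRatio fun θ r hr W hW hZ => ?_
  obtain ⟨H, i1, i2, i3, U, V, hUV, hU, hV⟩ := exists_inner_of_mem_convIncidence_two hW
  rw [show (2 : ℝ≥0∞) = ENNReal.ofReal 2 by simp]
  refine ENNReal.ofReal_le_ofReal (le_of_forall_nat_mul_sub_le (d := 2) fun n hn => ?_)
  have hn' : (n : ℝ) ≠ 0 := by positivity
  -- With `t = 1` the weights sum to zero, so that the shift `θ` does not contribute.
  have := identity_test (U := fun i => U ⟨i⟩) (V := fun j => V ⟨j⟩) (m := 1) (t := 1) (θ := θ) hr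
    (fun i j => by rw [← hUV, ← hZ]; rfl) (fun _ => hU _) (fun _ => hV _) zero_le_one
    one_le_two hn
  have e : (n : ℝ) * (1 - θ) - 1 / n * (2 * n - n ^ 2 - n ^ 2 * θ) = n * 2 - 2 := by
    field_simp
    ring
  linarith

theorem three_le_maxNorm_identitySim : 3 ≤ maxNorm identitySim.{u, v} := by
  rw [show (3 : ℝ≥0∞) = ENNReal.ofReal 3 by simp]
  refine ofReal_le_maxNorm fun H _ _ m U V hUV hU hV =>
    le_of_forall_nat_mul_sub_le (d := 4) fun n hn => ?_
  have hn' : (n : ℝ) ≠ 0 := by positivity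
  -- With `t = 2` the weights form a reflection.
  have := identity_test (U := fun i => U ⟨i⟩) (V := fun j => V ⟨j⟩) (c := 1) (t := 2) (θ := 0)
    zero_le_one (fun i j => by rw [← hUV, sub_zero, one_mul]; rfl) (fun _ => hU _)
    (fun _ => hV _) zero_le_two le_rfl hn
  have e : (n : ℝ) * (1 - 0) - 2 / n * (2 * n - n ^ 2 - n ^ 2 * 0) = n * 3 - 4 := by
    field_simp
    ring
  linarith

theorem ratios_identitySim :
    centralizedClusterRatio ℕ identitySim.{u, v} = 1 ∧
      centralizedClusterRatio (Fin 2) identitySim.{u, v} = 2 ∧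
      clusterRatio ℕ identitySim.{u, v} = 1 ∧ maxNorm identitySim.{u, v} = 3 := by
  have h1 : clusterRatio ℕ identitySim.{u, v} ≤ 1 := by
    rw [← ENNReal.ofReal_one]
    exact clusterRatio_le zero_le_one identitySim_mem_convIncidence fun x y => (one_mul _).symm
  have h2 : centralizedClusterRatio ℕ identitySim.{u, v} ≤ 1 := by
    rw [← ENNReal.ofReal_one]
    exact centralizedClusterRatio_le 0 zero_le_one identitySim_mem_convIncidence fun x y => by
      ring
  have h3 := centralizedClusterRatio_two_le (Γ := ℕ) identitySim.{u, v}
  have h4 := maxNorm_le_three_mul_clusterRatio (Γ := ℕ) identitySim.{u, v}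
  have h5 := two_le_centralizedClusterRatio_identitySim.{u, v}
  have h6 := three_le_maxNorm_identitySim.{u, v}
  refine ⟨h2.antisymm ?_, le_antisymm (h3.trans ?_) h5, h1.antisymm ?_,
    le_antisymm (h4.trans ?_) h6⟩
  · have := h5.trans h3
    rwa [← ENNReal.mul_le_mul_iff_right two_ne_zero ENNReal.ofNat_ne_top, mul_one]
  · simpa using mul_le_mul_right h2 2
  · have := h6.trans h4
    rwa [← ENNReal.mul_le_mul_iff_right three_ne_zero ENNReal.ofNat_ne_top, mul_one]
  · simpa using mul_le_mul_right h1 3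

/-! ### The comparison chains -/

theorem one_half_mul_le_of_le_two_mul {a b : ℝ≥0∞} (h : a ≤ 2 * b) : 1 / 2 * a ≤ b := by
  rwa [mul_comm, mul_one_div, ENNReal.div_le_iff' two_ne_zero ENNReal.ofNat_ne_top]

theorem one_third_mul_le_of_le_three_mul {a b : ℝ≥0∞} (h : a ≤ 3 * b) : 1 / 3 * a ≤ b := by
  rwa [mul_comm, mul_one_div, ENNReal.div_le_iff' three_ne_zero ENNReal.ofNat_ne_top]

variable {S : Type u} {T : Type v}

theorem centralizedClusterRatio_le_ratioConstant_mul (Z : S → T → ℝ) :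
    centralizedClusterRatio (Fin 2) Z ≤
      ENNReal.ofReal ratioConstant.{u, v} * centralizedMaxNorm Z := by
  rw [centralizedMaxNorm, ENNReal.mul_iInf_of_ne
    (by simpa using ratioConstant_pos.{u, v}) ENNReal.ofReal_ne_top]
  exact iInf_mono fun θ => isRatioBound_ratioConstant.2 _ _ _

theorem mem_convIncidence_two_of_maxNorm_le {Z : S → T → ℝ}
    (hZ : maxNorm Z ≤ ENNReal.ofReal (1 / ratioConstant.{u, v})) :
    Z ∈ convIncidence (Fin 2) S T := by
  refine mem_convIncidence_two_of_clusterRatio_le_one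
    ((isRatioBound_ratioConstant.2 _ _ _).trans ((mul_le_mul_right hZ _).trans ?_))
  rw [← ENNReal.ofReal_mul ratioConstant_pos.le, mul_one_div_cancel ratioConstant_pos.ne',
    ENNReal.ofReal_one]

theorem maxNorm_le_three_of_mem_convIncidence {Γ : Type} [MeasurableSpace Γ]
    [DiscreteMeasurableSpace Γ] [Countable Γ] {Z : S → T → ℝ} (hZ : Z ∈ convIncidence Γ S T) :
    maxNorm Z ≤ 3 := by
  simpa using maxNorm_smul_le_of_mem_convIncidence hZ zero_le_one

end

end HashCluster

end

open HashCluster in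
theorem mainTheorem1 :
    ∃ K : ℝ,
      (1.67 ≤ grothendieckConstant ∧ grothendieckConstant ≤ K ∧
        K ≤ krivineConstant ∧ krivineConstant ≤ 1.79) ∧
      -- the two chains of inequalities, for all domains, similarities and alphabet sizes
      (∀ (S : Type u) (T : Type v) (sim : S → T → ℝ) (k : ℕ), 2 ≤ k →
        (1 / 2 * centralizedMaxNorm sim ≤ 1 / 2 * centralizedClusterRatio (Fin 2) sim ∧
          1 / 2 * centralizedClusterRatio (Fin 2) sim ≤ centralizedClusterRatio ℕ sim ∧
          centralizedClusterRatio ℕ sim ≤ centralizedClusterRatio (Fin k) sim ∧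
          centralizedClusterRatio (Fin k) sim ≤ centralizedClusterRatio (Fin 2) sim ∧
          centralizedClusterRatio (Fin 2) sim ≤ ENNReal.ofReal K * centralizedMaxNorm sim) ∧
        (1 / 3 * maxNorm sim ≤ clusterRatio ℕ sim ∧
          clusterRatio ℕ sim ≤ clusterRatio (Fin k) sim ∧
          clusterRatio (Fin k) sim ≤ clusterRatio (Fin 2) sim ∧
          clusterRatio (Fin 2) sim ≤ ENNReal.ofReal K * maxNorm sim)) ∧
      -- the max-norm ball as a relaxation of the convex hull
      (∀ (S : Type u) (T : Type v) (k : ℕ), 2 ≤ k →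
        ({Z : S → T → ℝ | maxNorm Z ≤ ENNReal.ofReal (1 / K)} ⊆ convIncidence (Fin k) S T ∧
          convIncidence (Fin k) S T ⊆ {Z : S → T → ℝ | maxNorm Z ≤ 3}) ∧
        ({Z : S → T → ℝ | maxNorm Z ≤ ENNReal.ofReal (1 / K)} ⊆ convIncidence ℕ S T ∧
          convIncidence ℕ S T ⊆ {Z : S → T → ℝ | maxNorm Z ≤ 3})) ∧
      -- the least `α` admitting an `α`-ALSH
      (∀ (S : Type u) (T : Type v) (sim : S → T → ℝ) (k : ℕ), 2 ≤ k →
        (leastALSH (Fin k) sim = centralizedClusterRatio (Fin k) sim ∧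
          1 / 2 * centralizedMaxNorm sim ≤ leastALSH (Fin k) sim ∧
          leastALSH (Fin k) sim ≤ ENNReal.ofReal K * centralizedMaxNorm sim) ∧
        (leastALSH ℕ sim = centralizedClusterRatio ℕ sim ∧
          1 / 2 * centralizedMaxNorm sim ≤ leastALSH ℕ sim ∧
          leastALSH ℕ sim ≤ ENNReal.ofReal K * centralizedMaxNorm sim)) ∧
      -- tightness of the inequalities between the centralized quantities
      ((∃ (S : Type u) (T : Type v) (sim : S → T → ℝ),
          0 < centralizedClusterRatio (Fin 2) sim ∧ centralizedClusterRatio (Fin 2) sim < ∞ ∧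
          1 / 2 * centralizedMaxNorm sim = 1 / 2 * centralizedClusterRatio (Fin 2) sim) ∧
        (∃ (S : Type u) (T : Type v) (sim : S → T → ℝ),
          0 < centralizedClusterRatio ℕ sim ∧ centralizedClusterRatio ℕ sim < ∞ ∧
          1 / 2 * centralizedClusterRatio (Fin 2) sim = centralizedClusterRatio ℕ sim) ∧
        (∀ k : ℕ, 2 ≤ k → ∃ (S : Type u) (T : Type v) (sim : S → T → ℝ),
          0 < centralizedClusterRatio (Fin k) sim ∧ centralizedClusterRatio (Fin k) sim < ∞ ∧
          centralizedClusterRatio ℕ sim = centralizedClusterRatio (Fin k) sim) ∧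
        (∀ k : ℕ, 2 ≤ k → ∃ (S : Type u) (T : Type v) (sim : S → T → ℝ),
          0 < centralizedClusterRatio (Fin 2) sim ∧ centralizedClusterRatio (Fin 2) sim < ∞ ∧
          centralizedClusterRatio (Fin k) sim = centralizedClusterRatio (Fin 2) sim) ∧
        (∀ c : ℝ, c < K → ∃ (S : Type u) (T : Type v) (sim : S → T → ℝ),
          ENNReal.ofReal c * centralizedMaxNorm sim < centralizedClusterRatio (Fin 2) sim)) ∧
      -- tightness of the inequalities between the uncentralized quantities
      ((∃ (S : Type u) (T : Type v) (sim : S → T → ℝ),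
          0 < clusterRatio ℕ sim ∧ clusterRatio ℕ sim < ∞ ∧
          1 / 3 * maxNorm sim = clusterRatio ℕ sim) ∧
        (∀ k : ℕ, 2 ≤ k → ∃ (S : Type u) (T : Type v) (sim : S → T → ℝ),
          0 < clusterRatio (Fin k) sim ∧ clusterRatio (Fin k) sim < ∞ ∧
          clusterRatio ℕ sim = clusterRatio (Fin k) sim) ∧
        (∀ k : ℕ, 2 ≤ k → ∃ (S : Type u) (T : Type v) (sim : S → T → ℝ),
          0 < clusterRatio (Fin 2) sim ∧ clusterRatio (Fin 2) sim < ∞ ∧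
          clusterRatio (Fin k) sim = clusterRatio (Fin 2) sim) ∧
        (∀ c : ℝ, c < K → ∃ (S : Type u) (T : Type v) (sim : S → T → ℝ),
          ENNReal.ofReal c * maxNorm sim < clusterRatio (Fin 2) sim)) := by
  have hmono {k : ℕ} (hk : 2 ≤ k) := convIncidence_fin_subset_fin.{u, v} hk
  have hnat := convIncidence_fin_subset_nat.{u, v}
  have hlow {S : Type u} {T : Type v} (Z : S → T → ℝ) :
      1 / 2 * centralizedMaxNorm Z ≤ 1 / 2 * centralizedClusterRatio (Fin 2) Z :=
    mul_le_mul_right (centralizedMaxNorm_le_two Z) _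
  have htwo {S : Type u} {T : Type v} {Γ : Type} [MeasurableSpace Γ] [DiscreteMeasurableSpace Γ]
      [Countable Γ] (Z : S → T → ℝ) :
      1 / 2 * centralizedClusterRatio (Fin 2) Z ≤ centralizedClusterRatio Γ Z :=
    one_half_mul_le_of_le_two_mul (centralizedClusterRatio_two_le Z)
  have hup {S : Type u} {T : Type v} (Z : S → T → ℝ) :=
    centralizedClusterRatio_le_ratioConstant_mul Z
  have hsign2 := clusterRatio_signSim.{u, v} (Γ := Fin 2) fun _ _ => subset_rfl
  have hsignk {k : ℕ} (hk : 2 ≤ k) := clusterRatio_signSim.{u, v} (hmono hk)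
  have hsignN := clusterRatio_signSim.{u, v} (hnat 2)
  obtain ⟨hid1, hid2, hid3, hid4⟩ := ratios_identitySim.{u, v}
  refine ⟨ratioConstant.{u, v}, ⟨le_grothendieckConstant,
    grothendieckConstant_le_ratioConstant, ratioConstant_le_krivineConstant, krivineConstant_le⟩,
    fun S T sim k hk => ⟨⟨hlow sim, htwo sim, centralizedClusterRatio_mono (hnat k S T) sim,
      centralizedClusterRatio_mono (hmono hk S T) sim, hup sim⟩,
      ⟨one_third_mul_le_of_le_three_mul (maxNorm_le_three_mul_clusterRatio sim),
      clusterRatio_mono (hnat k S T) sim, clusterRatio_mono (hmono hk S T) sim,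
      isRatioBound_ratioConstant.2 S T sim⟩⟩,
    fun S T k hk => ⟨⟨fun Z hZ => hmono hk S T (mem_convIncidence_two_of_maxNorm_le hZ),
      fun Z hZ => maxNorm_le_three_of_mem_convIncidence hZ⟩,
      fun Z hZ => hnat 2 S T (mem_convIncidence_two_of_maxNorm_le hZ),
      fun Z hZ => maxNorm_le_three_of_mem_convIncidence hZ⟩,
    fun S T sim k hk => ?_,
    ⟨⟨_, _, signSim, ?_⟩, ⟨_, _, identitySim, ?_⟩, fun k hk => ⟨_, _, signSim, ?_⟩,
      fun k hk => ⟨_, _, signSim, ?_⟩, fun c hc => exists_lt_centralizedClusterRatio hc⟩,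
    ⟨_, _, identitySim, ?_⟩, fun k hk => ⟨_, _, signSim, ?_⟩, fun k hk => ⟨_, _, signSim, ?_⟩,
    fun c hc => exists_lt_clusterRatio hc⟩
  · have : Nonempty (Fin k) := ⟨⟨0, by omega⟩⟩
    rw [leastALSH_eq, leastALSH_eq]
    exact ⟨⟨rfl, (hlow sim).trans (htwo sim),
      (centralizedClusterRatio_mono (hmono hk S T) sim).trans (hup sim)⟩,
      rfl, (hlow sim).trans (htwo sim),
      (centralizedClusterRatio_mono (hnat 2 S T) sim).trans (hup sim)⟩
  · rw [hsign2.2, centralizedMaxNorm_signSim]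
    simp
  · rw [hid1, hid2]
    exact ⟨one_pos, ENNReal.one_lt_top, ENNReal.div_mul_cancel two_ne_zero ENNReal.ofNat_ne_top⟩
  · rw [hsignN.2, (hsignk hk).2]
    simp
  · rw [hsign2.2, (hsignk hk).2]
    simp
  · rw [hid3, hid4]
    exact ⟨one_pos, ENNReal.one_lt_top, ENNReal.div_mul_cancel three_ne_zero ENNReal.ofNat_ne_top⟩
  · rw [hsignN.1, (hsignk hk).1]
    simp
  · rw [hsign2.1, (hsignk hk).1]
    simp
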